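/- **Setting.** Let $d,d_a,d_u\in\mathbb N$, $s,s'>0$, and $\alpha\in\mathbb R$ with $\alpha\notin\pi\mathbb Z$. Let $\mathcal T_\alpha^d$ be the fractional torus of order $\alpha$, that is, the cube $[0,|\sin\alpha|]^d$ with opposite sides identified, with Lebesgue measure. For $r>0$ let $H^r(\mathcal T_\alpha^d;\mathbb R^n)$ be the space of all $v\in L^2(\mathcal T_\alpha^d;\mathbb R^n)$ with $$\|v\|_{H^r}^2=\sum_{k\in\mathbb Z^d}(1+|k|^2)^r|\hat v(k)|^2<\infty,\qquad \hat v(k)=|\sin\alpha|^{-d}\int_{\mathcal T_\alpha^d}v(x)e^{-2\pi i k\cdot x/|\sin\alpha|}\,dx .$$ **Fractional Fourier transform.** For $m\in\mathbb Z^d$ put $e_\alpha(x)=e^{i\pi|x|^2\cot\alpha}$, $e_\alpha(m,x)=e^{-2\pi i(m\cdot x)\csc\alpha}$, $A_\alpha=\sqrt{1-i\cot\alpha}$ (principal branch) and $K_\alpha(m,x)=A_\alpha^d\,e_\alpha(x)\,e_\alpha(m,x)\,e_\alpha(m)$. For $f:\mathcal T_\alpha^d\to\mathbb C^p$ let $\mathcal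 F^\alpha(f)(m)=\int_{\mathcal T_\alpha^d}f(x)K_\alpha(m,x)\,dx$. For finitely supported $c:\mathbb Z^d\to\mathbb C^p$ let $\mathcal F^{-\alpha}(c)(x)=\sum_m c(m)K_{-\alpha}(m,x)$. **CoNO.** Let $\sigma(z)=\mathrm{GeLU}(\operatorname{Re}z)+i\,\mathrm{GeLU}(\operatorname{Im}z)$ on $\mathbb C$, acting componentwise on $\mathbb C^p$, where $\mathrm{GeLU}(t)=t\,\Phi(t)$ and $\Phi$ is the standard Gaussian distribution function. A *CoNO* of order $\alpha$ is a map of the form $$v\mapsto \mathcal Q\circ\mathcal L_l\circ(\sigma\circ\mathcal L_{l-1})\circ\dots\circ(\sigma\circ\mathcal L_1)\circ\mathcal P(v),\qquad l\ge 1,$$ with arbitrary finite numbers $d_1,\dots,d_{l+1}$ of channels, where: * the lifting $\mathcal P$ is a real linear map applied pointwise to $v(x)\in\mathbb R^{d_a}$ and a position embedding: $\mathcal P(v)(x)=Av(x)+\sum_{|k|_\infty\le N_0}\big(\operatorname{Re}\mathcal R(k,x)\,B_k+\operatorname{Im}\mathcal R(k,x)\,C_k\big)$, with $\mathcal R(k,x)=e_\alpha(k)e_\alpha(k,x)$,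 $N_0\in\mathbb N$, $A\in\mathbb R^{d_1\times d_a}$ and $B_k,C_k\in\mathbb R^{d_1}$; * the $j$-th layer is $\mathcal L_j(w)(x)=W_jw(x)+b_j+\mathcal F^{-\alpha}\big(\mathbf 1_{|k|_\infty\le N_j}R_j(k)\,\mathcal F^\alpha(w)(k)\big)(x)$, with $W_j,R_j(k)\in\mathbb C^{d_{j+1}\times d_j}$, $b_j\in\mathbb C^{d_{j+1}}$ and $N_j\in\mathbb N$; * the projection is $\mathcal Q(w)(x)=\operatorname{Re}(Q\,w(x))$ with $Q\in\mathbb C^{d_u\times d_{l+1}}$. **Theorem (universal approximation of CoNO).** Let $\mathcal G:H^s(\mathcal T_\alpha^d;\mathbb R^{d_a})\to H^{s'}(\mathcal T_\alpha^d;\mathbb R^{d_u})$ be a continuous (not necessarily linear) operator and let $K\subset H^s(\mathcal T_\alpha^d;\mathbb R^{d_a})$ be compact. Then for every $\varepsilon>0$ there is a CoNO $\mathcal N$ of order $\alpha$ that maps all of $H^s(\mathcal T_\alpha^d;\mathbb R^{d_a})$ into $H^{s'}(\mathcal T_\alpha^d;\mathbb R^{d_u})$ and satisfies $$\sup_{v\in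 K}\|\mathcal G(v)-\mathcal N(v)\|_{L^2(\mathcal T_\alpha^d)}\le\varepsilon .$$ -/

import Mathlib

open MeasureTheory
open scoped Matrix

noncomputable section

namespace CoNO

/-! ### The fractional torus and its Sobolev spaces -/

/-- The cube `[0, |sin α|]^d`, the fundamental domain of the fractional torus of order `α`.
The identification of opposite sides concerns a null set only, so it is invisible in `L²`; it enters
the Sobolev spaces below, which are defined through the `|sin α|`-periodic characters. -/
def cube (α : ℝ) (d : ℕ) : Set (Fin d → ℝ) := Set.Icc 0 (fun _ => |Real.sin α|)

/-- Lebesgue measure on the fractional torus. -/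
def torusMeasure (α : ℝ) (d : ℕ) : Measure (Fin d → ℝ) := volume.restrict (cube α d)

instance (α : ℝ) (d : ℕ) : IsFiniteMeasure (torusMeasure α d) :=
  ⟨by
    rw [torusMeasure, Measure.restrict_apply_univ]
    exact (isCompact_Icc : IsCompact (Set.Icc (0 : Fin d → ℝ) _)).measure_lt_top⟩

/-- `L²(T_α^d; ℝⁿ)`. -/
abbrev L2Space (α : ℝ) (d n : ℕ) : Type :=
  Lp (EuclideanSpace ℝ (Fin n)) 2 (torusMeasure α d)

/-- The ordinary character `x ↦ exp(-2πi k·x / |sin α|)` of the torus `ℝ^d / |sin α| ℤ^d`. -/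
def character (α : ℝ) {d : ℕ} (k : Fin d → ℤ) (x : Fin d → ℝ) : ℂ :=
  Complex.exp (((-2 * Real.pi * (∑ i, (k i : ℝ) * x i) / |Real.sin α| : ℝ) : ℂ) * Complex.I)

/-- The ordinary `k`-th Fourier coefficient (a vector in `ℂⁿ`) of an `ℝⁿ`-valued function. -/
def fourierCoeff (α : ℝ) {d n : ℕ} (v : (Fin d → ℝ) → EuclideanSpace ℝ (Fin n))
    (k : Fin d → ℤ) : EuclideanSpace ℂ (Fin n) :=
  WithLp.toLp 2 fun j =>
    ((|Real.sin α| ^ d : ℝ) : ℂ)⁻¹ * ∫ x, ((v x j : ℝ) : ℂ) * character α k x ∂torusMeasure α d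

/-- The Fourier coefficients with weights, `(1 + |k|²)^{s/2} v̂(k)`. -/
def weightedCoeff (α s : ℝ) {d n : ℕ} (v : (Fin d → ℝ) → EuclideanSpace ℝ (Fin n))
    (k : Fin d → ℤ) : EuclideanSpace ℂ (Fin n) :=
  ((1 + ∑ i, (k i : ℝ) ^ 2) ^ (s / 2) : ℝ) • fourierCoeff α v k

theorem integrable_coord_mul_character (α : ℝ) {d n : ℕ} (v : L2Space α d n) (k : Fin d → ℤ)
    (j : Fin n) :
    Integrable (fun x => ((v x j : ℝ) : ℂ) * character α k x) (torusMeasure α d) := by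
  have h1 : Integrable (fun x => v x) (torusMeasure α d) :=
    (Lp.memLp v).integrable (by norm_num)
  have h2 : Integrable (fun x => v x j) (torusMeasure α d) :=
    (EuclideanSpace.proj (𝕜 := ℝ) j).integrable_comp h1
  have hc : Continuous (character α k : (Fin d → ℝ) → ℂ) := by
    unfold character; fun_prop
  refine h2.ofReal.mul_bdd (c := 1) hc.aestronglyMeasurable (Filter.Eventually.of_forall fun x => ?_)
  unfold character
  rw [Complex.norm_exp_ofReal_mul_I]

theorem weightedCoeff_add (α s : ℝ) {d n : ℕ} (v w : L2Space α d n) :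
    weightedCoeff α s ⇑(v + w) = weightedCoeff α s ⇑v + weightedCoeff α s ⇑w := by
  funext k
  ext j
  simp only [weightedCoeff, fourierCoeff, Pi.add_apply, PiLp.smul_apply, PiLp.add_apply]
  rw [← smul_add, ← mul_add, ← integral_add (integrable_coord_mul_character α v k j)
    (integrable_coord_mul_character α w k j)]
  congr 2
  refine integral_congr_ae ?_
  filter_upwards [Lp.coeFn_add v w] with x hx
  rw [hx]
  simp [add_mul]

theorem weightedCoeff_smul (α s c : ℝ) {d n : ℕ} (v : L2Space α d n) :
    weightedCoeff α s ⇑(c • v) = c • weightedCoeff α s ⇑v := by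
  funext k
  ext j
  have h : ∫ x, (((c • v : L2Space α d n) x j : ℝ) : ℂ) * character α k x ∂torusMeasure α d =
      (c : ℂ) * ∫ x, ((v x j : ℝ) : ℂ) * character α k x ∂torusMeasure α d := by
    rw [← integral_const_mul]
    refine integral_congr_ae ?_
    filter_upwards [Lp.coeFn_smul c v] with x hx
    rw [hx]
    simp [mul_assoc]
  simp only [weightedCoeff, fourierCoeff, Pi.smul_apply, PiLp.smul_apply, h, Complex.real_smul]
  ring

/-- The functions `v ∈ L²(T_α^d; ℝⁿ)` with `∑_k (1 + |k|²)^s |v̂(k)|² < ∞`. -/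
def sobolevSubmodule (α s : ℝ) (d n : ℕ) : Submodule ℝ (L2Space α d n) where
  carrier := {v | Memℓp (weightedCoeff α s ⇑v) 2}
  add_mem' {v w} hv hw := by
    simp only [Set.mem_ofPred_eq, weightedCoeff_add] at *
    exact hv.add hw
  zero_mem' := by
    have h := weightedCoeff_smul α s 0 (0 : L2Space α d n)
    rw [zero_smul, zero_smul] at h
    simp only [Set.mem_ofPred_eq, h]
    exact zero_memℓp
  smul_mem' c v hv := by
    simp only [Set.mem_ofPred_eq, weightedCoeff_smul] at *
    exact hv.const_smul c

/-- The Sobolev space `H^s(T_α^d; ℝⁿ)`. It is not given the topology of `L²` but that of the norm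
`‖v‖_{H^s} = (∑_k (1 + |k|²)^s |v̂(k)|²)^{1/2}`. -/
def Sobolev (α s : ℝ) (d n : ℕ) : Type := ↥(sobolevSubmodule α s d n)

instance (α s : ℝ) (d n : ℕ) : AddCommGroup (Sobolev α s d n) :=
  inferInstanceAs (AddCommGroup ↥(sobolevSubmodule α s d n))

instance (α s : ℝ) (d n : ℕ) : Module ℝ (Sobolev α s d n) :=
  inferInstanceAs (Module ℝ ↥(sobolevSubmodule α s d n))

/-- The inclusion of `H^s(T_α^d; ℝⁿ)` in `L²(T_α^d; ℝⁿ)`. -/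
def Sobolev.toL2 {α s : ℝ} {d n : ℕ} (v : Sobolev α s d n) : L2Space α d n := v.1

/-- The map `v ↦ ((1 + |k|²)^{s/2} v̂(k))_k` from `H^s` to `ℓ²`. -/
def Sobolev.toLittleL2 (α s : ℝ) (d n : ℕ) :
    Sobolev α s d n →ₗ[ℝ] lp (fun _ : Fin d → ℤ => EuclideanSpace ℂ (Fin n)) 2 where
  toFun v := ⟨weightedCoeff α s ⇑v.toL2, v.2⟩
  map_add' v w := Subtype.ext (weightedCoeff_add α s v.toL2 w.toL2)
  map_smul' c v := Subtype.ext (weightedCoeff_smul α s c v.toL2)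

/-- The `H^s` norm, pulled back from `ℓ²`. -/
instance (α s : ℝ) (d n : ℕ) : SeminormedAddCommGroup (Sobolev α s d n) :=
  SeminormedAddCommGroup.induced _ _ (Sobolev.toLittleL2 α s d n)

/-! ### The fractional Fourier transform on the fractional torus -/

/-- The chirp `e_α(x) = exp(iπ |x|² cot α)`. -/
def chirp (α : ℝ) {d : ℕ} (x : Fin d → ℝ) : ℂ :=
  Complex.exp (((Real.pi * (∑ i, x i ^ 2) * Real.cot α : ℝ) : ℂ) * Complex.I)

/-- `e_α(m, x) = exp(-2πi (m·x) csc α)`. -/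
def fracChar (α : ℝ) {d : ℕ} (m : Fin d → ℤ) (x : Fin d → ℝ) : ℂ :=
  Complex.exp (((-2 * Real.pi * (∑ i, (m i : ℝ) * x i) / Real.sin α : ℝ) : ℂ) * Complex.I)

/-- The kernel `K_α(m, x) = A_α^d e_α(x) e_α(m, x) e_α(m)` with `A_α = √(1 - i cot α)`
(principal branch). -/
def fracKernel (α : ℝ) {d : ℕ} (m : Fin d → ℤ) (x : Fin d → ℝ) : ℂ :=
  ((1 - Complex.I * (Real.cot α : ℂ)) ^ (1 / 2 : ℂ)) ^ d *
    chirp α x * fracChar α m x * chirp α (fun i => (m i : ℝ))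

/-- The `m`-th fractional Fourier coefficient of order `α` of a `ℂᵖ`-valued function:
`F^α(f)(m) = ∫ f(x) K_α(m, x) dx` over the fractional torus, in every component. -/
def frft (α : ℝ) {d p : ℕ} (f : (Fin d → ℝ) → Fin p → ℂ) (m : Fin d → ℤ) : Fin p → ℂ :=
  fun j => ∫ x, f x j * fracKernel α m x ∂torusMeasure α d

/-- The wave numbers `{k ∈ ℤ^d : |k|_∞ ≤ N}`. -/
def waveNumbers (d N : ℕ) : Finset (Fin d → ℤ) :=
  Fintype.piFinset fun _ => Finset.Icc (-(N : ℤ)) N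

/-- The inverse transform `F^{-α}` of coefficients truncated at `|k|_∞ ≤ N`:
`x ↦ ∑_{|k|_∞ ≤ N} c(k) K_{-α}(k, x)`. -/
def inverseFrft (α : ℝ) {d p : ℕ} (N : ℕ) (c : (Fin d → ℤ) → Fin p → ℂ)
    (x : Fin d → ℝ) : Fin p → ℂ :=
  ∑ k ∈ waveNumbers d N, fracKernel (-α) k x • c k

/-! ### Complex neural operators -/

/-- `GeLU(x) = x Φ(x)`, with `Φ` the distribution function of the standard Gaussian. -/
def gelu (x : ℝ) : ℝ := x * ProbabilityTheory.cdf (ProbabilityTheory.gaussianReal 0 1) x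

/-- `CGeLU(z) = GeLU(Re z) + i GeLU(Im z)`. -/
def cgelu (z : ℂ) : ℂ := (gelu z.re : ℂ) + Complex.I * (gelu z.im : ℂ)

/-- The parameters of a CoNO layer from `p` to `q` complex channels: the matrix `W`, the bias `b`,
the truncation `N` and the spectral multiplier `R(k)` of the fractional integral operator. -/
structure Layer (d p q : ℕ) where
  W : Matrix (Fin q) (Fin p) ℂ
  b : Fin q → ℂ
  N : ℕ
  R : (Fin d → ℤ) → Matrix (Fin q) (Fin p) ℂ

/-- The layer before activation:
`v ↦ (x ↦ W v(x) + b + F^{-α}(R · F^α v)(x))`. -/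
def Layer.apply {d p q : ℕ} (L : Layer d p q) (α : ℝ) (v : (Fin d → ℝ) → Fin p → ℂ)
    (x : Fin d → ℝ) : Fin q → ℂ :=
  L.W *ᵥ v x + L.b + inverseFrft α L.N (fun k => L.R k *ᵥ frft α v k) x

/-- A chain of one or more CoNO layers with matching numbers of channels. -/
inductive Layers (d : ℕ) : ℕ → ℕ → Type
  | last {p q : ℕ} (L : Layer d p q) : Layers d p q
  | cons {p r q : ℕ} (L : Layer d p r) (rest : Layers d r q) : Layers d p q

/-- The map of a chain of layers: the activation follows every layer except the last one. -/
def Layers.apply {d : ℕ} (α : ℝ) : {p q : ℕ} → Layers d p q →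
    ((Fin d → ℝ) → Fin p → ℂ) → (Fin d → ℝ) → Fin q → ℂ
  | _, _, .last L, v => L.apply α v
  | _, _, .cons L rest, v => rest.apply α fun x j => cgelu (L.apply α v x j)

/-- The fractional Fourier basis function `e_α(k) e_α(k, x)` used for the position embedding. -/
def fracBasis (α : ℝ) {d : ℕ} (k : Fin d → ℤ) (x : Fin d → ℝ) : ℂ :=
  chirp α (fun i => (k i : ℝ)) * fracChar α k x

/-- The parameters of the lifting: a real linear map applied to `v(x)` together with the position
embedding `Re e_α(k) e_α(k, x)`, `Im e_α(k) e_α(k, x)`, `|k|_∞ ≤ N`. -/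
structure Lifting (d da p : ℕ) where
  N : ℕ
  A : Matrix (Fin p) (Fin da) ℝ
  B : (Fin d → ℤ) → Fin p → ℝ
  C : (Fin d → ℤ) → Fin p → ℝ

/-- The lifting, which acts pointwise. -/
def Lifting.apply {d da p : ℕ} (P : Lifting d da p) (α : ℝ)
    (v : (Fin d → ℝ) → EuclideanSpace ℝ (Fin da)) (x : Fin d → ℝ) : Fin p → ℂ :=
  fun j => (((P.A *ᵥ fun i => v x i) j + ∑ k ∈ waveNumbers d P.N,
    ((fracBasis α k x).re * P.B k j + (fracBasis α k x).im * P.C k j) : ℝ) : ℂ)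

/-- A complex neural operator: lifting, CoNO layers, and a linear projection `Q` to `du` real
channels. -/
structure Network (d da du : ℕ) where
  p : ℕ
  q : ℕ
  lift : Lifting d da p
  layers : Layers d p q
  Q : Matrix (Fin du) (Fin q) ℂ

/-- The map `Q ∘ L_l ∘ (σ L_{l-1}) ∘ ⋯ ∘ (σ L_1) ∘ P` of a complex neural operator on the fractional
torus of order `α`, where `Q` acts pointwise by `z ↦ Re (Q z)`. -/
def Network.apply {d da du : ℕ} (𝒩 : Network d da du) (α : ℝ)
    (v : (Fin d → ℝ) → EuclideanSpace ℝ (Fin da)) (x : Fin d → ℝ) : EuclideanSpace ℝ (Fin du) :=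
  WithLp.toLp 2 fun i => ((𝒩.Q *ᵥ 𝒩.layers.apply α (𝒩.lift.apply α v) x) i).re

end CoNO

end

/-! Composed with the inclusion of H^{s'} in L², the operator is continuous on the compact set K, so
a partition of unity approximates it uniformly by finite sums of terms c(v) u(x), with c continuous
and u in a dense subspace of L² (`exists_finset_approx`). It remains to imitate such sums uniformly
on K × cube by a network with one hidden layer, while its output stays in H^{s'} for every input
field.

The real parts of the inputs of hidden units form a real vector space (`preactivations`). It
contains the real trigonometric polynomials, through the position embedding, and the real and
imaginary parts of K_{-α}(k,x) F^α(v)(k), through the spectral multipliers. By the Mills ratio,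
-gelu(-(n + t/n))/φ(n) tends to e^{-t}, so rescaled hidden units converge to exponentials of
preactivations. These exponentials are closed under products, hence span an algebra, and
Stone-Weierstrass applies. The kernel has no zeros and the fractional coefficients determine v, so
this algebra separates the points of K × open cube. What may go wrong is the boundary, where
trigonometric polynomials cannot tell opposite faces apart.

Regularity is a second boundary problem: the fractional kernel need not be periodic, so a single
hidden unit need not lie in H^{s'}. Both problems have the same cure. Let p = ∏ sin^{2r}(π x_j/|sin
α|), a trigonometric polynomial vanishing on the boundary to order 2r, and use only differences
gelu(h + t p) - gelu(h). Their extensions by zero are C^m for m < 2r, and integration by parts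
places them in H^{s'} (`exists_sobolev_of_mem_flatSubmodule`). Their rescaled limits are (e^p - 1)
e^h, and the weight e^p - 1 vanishes, within the cube, exactly on the boundary
(`bumpWeightMap_mul_mem`, `mem_closure_adjoin_expSet`). The fields u are therefore taken of the form
(e^p - 1)² q with q trigonometric: one factor hides the boundary from Stone-Weierstrass, the other
comes from the differences. Such fields are still dense because the weight is positive almost
everywhere (`weightedTrig_topologicalClosure`). -/

noncomputable section

namespace CoNO

open Filter Topology ProbabilityTheory

/-! ### The activation function -/

/-- The standard Gaussian density. -/
def gaussDensity (x : ℝ) : ℝ := gaussianPDFReal 0 1 x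

theorem gaussDensity_eq (x : ℝ) :
    gaussDensity x = (√(2 * Real.pi))⁻¹ * Real.exp (-x ^ 2 / 2) := by
  simp [gaussDensity, gaussianPDFReal]

theorem gaussDensity_pos (x : ℝ) : 0 < gaussDensity x :=
  gaussianPDFReal_pos 0 1 x one_ne_zero

theorem gaussDensity_neg (x : ℝ) : gaussDensity (-x) = gaussDensity x := by
  simp [gaussDensity_eq]

theorem contDiff_gaussDensity : ContDiff ℝ ⊤ gaussDensity := by
  have : gaussDensity = fun x => (√(2 * Real.pi))⁻¹ * Real.exp (-x ^ 2 / 2) :=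
    funext gaussDensity_eq
  rw [this]
  fun_prop

theorem hasDerivAt_gaussDensity (x : ℝ) :
    HasDerivAt gaussDensity (-x * gaussDensity x) x := by
  have h : gaussDensity = fun x => (√(2 * Real.pi))⁻¹ * Real.exp (-x ^ 2 / 2) :=
    funext gaussDensity_eq
  rw [h]
  have h1 : HasDerivAt (fun x : ℝ => -x ^ 2 / 2) (-x) x := by
    have := ((hasDerivAt_id x).pow 2).neg.div_const 2
    exact this.congr_deriv (by simp; ring)
  exact (h1.exp.const_mul (√(2 * Real.pi))⁻¹).congr_deriv (by ring)

theorem hasDerivAt_cdf_gaussianReal (x : ℝ) :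
    HasDerivAt (cdf (gaussianReal 0 1)) (gaussDensity x) x := by
  have hint : Integrable gaussDensity := integrable_gaussianPDFReal 0 1
  have h1 : ∀ y, cdf (gaussianReal 0 1) y = ∫ t in Set.Iic y, gaussDensity t := by
    intro y
    rw [cdf_eq_real, measureReal_def, gaussianReal_apply_eq_integral 0 one_ne_zero,
      ENNReal.toReal_ofReal (integral_nonneg fun t => gaussianPDFReal_nonneg 0 1 t)]
    rfl
  have h2 : ⇑(cdf (gaussianReal 0 1)) =
      fun y => (∫ t in Set.Iic 0, gaussDensity t) + ∫ t in (0 : ℝ)..y, gaussDensity t := by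
    funext y
    rw [h1, ← intervalIntegral.integral_Iic_sub_Iic hint.integrableOn hint.integrableOn]
    ring
  rw [h2]
  exact (intervalIntegral.integral_hasDerivAt_right hint.intervalIntegrable
    (contDiff_gaussDensity.continuous.stronglyMeasurableAtFilter _ _)
    contDiff_gaussDensity.continuous.continuousAt).const_add _

theorem contDiff_gelu : ContDiff ℝ (⊤ : ℕ∞) gelu := by
  have h : ContDiff ℝ (⊤ : ℕ∞) (cdf (gaussianReal 0 1)) := by
    rw [contDiff_infty_iff_deriv]
    refine ⟨fun x => (hasDerivAt_cdf_gaussianReal x).differentiableAt, ?_⟩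
    rw [show deriv (cdf (gaussianReal 0 1)) = gaussDensity from
      funext fun x => (hasDerivAt_cdf_gaussianReal x).deriv]
    exact contDiff_gaussDensity.of_le le_top
  exact contDiff_id.mul h

/-- The asymptotics of the Mills ratio of the Gaussian law. -/
theorem tendsto_mills_ratio :
    Tendsto (fun x => x * cdf (gaussianReal 0 1) (-x) / gaussDensity x) atTop (𝓝 1) := by
  have hd : Tendsto gaussDensity atTop (𝓝 0) := by
    have h : gaussDensity = fun x => (√(2 * Real.pi))⁻¹ * Real.exp (-x ^ 2 / 2) :=
      funext gaussDensity_eq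
    rw [h, ← mul_zero (√(2 * Real.pi))⁻¹]
    refine Tendsto.const_mul _ (Real.tendsto_exp_atBot.comp ?_)
    have : Tendsto (fun x : ℝ => x ^ 2 / 2) atTop atTop :=
      (tendsto_pow_atTop two_ne_zero).atTop_div_const two_pos
    simpa only [neg_div, Function.comp_def] using tendsto_neg_atTop_atBot.comp this
  have key : Tendsto (fun x => cdf (gaussianReal 0 1) (-x) / (gaussDensity x * x⁻¹)) atTop
      (𝓝 1) := by
    -- L'Hôpital for Φ(-x) against φ(x)/x: since φ' = -xφ, the quotient of the derivatives is 1/(1 +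
    -- x⁻²).
    refine HasDerivAt.lhopital_zero_atTop (f' := fun x => -gaussDensity x)
      (g' := fun x => -gaussDensity x * (1 + (x ^ 2)⁻¹)) ?_ ?_ ?_ ?_ ?_ ?_
    · filter_upwards with x
      have := (hasDerivAt_cdf_gaussianReal (-x)).comp x (hasDerivAt_neg x)
      exact this.congr_deriv (by rw [gaussDensity_neg]; ring)
    · filter_upwards [eventually_gt_atTop 0] with x hx
      exact ((hasDerivAt_gaussDensity x).mul (hasDerivAt_inv hx.ne')).congr_deriv
        (by field_simp; ring)
    · filter_upwards with x
      have := gaussDensity_pos x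
      have : 0 < gaussDensity x * (1 + (x ^ 2)⁻¹) := by positivity
      linarith
    · exact (tendsto_cdf_atBot _).comp tendsto_neg_atTop_atBot
    · simpa using hd.mul tendsto_inv_atTop_zero
    · have h : ∀ x : ℝ, -gaussDensity x / (-gaussDensity x * (1 + (x ^ 2)⁻¹)) =
          (1 + (x ^ 2)⁻¹)⁻¹ := by
        intro x
        have := (gaussDensity_pos x).ne'
        rw [div_mul_eq_div_div, div_self (neg_ne_zero.mpr this), one_div]
      simp_rw [h]
      have : Tendsto (fun x : ℝ => 1 + (x ^ 2)⁻¹) atTop (𝓝 (1 + 0)) :=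
        (tendsto_inv_atTop_zero.comp (tendsto_pow_atTop two_ne_zero)).const_add 1
      simpa using this.inv₀ (by norm_num)
  refine key.congr' ?_
  filter_upwards [eventually_gt_atTop 0] with x hx
  have := (gaussDensity_pos x).ne'
  field_simp

/-- Far to the left and suitably rescaled, GeLU looks like an exponential. -/
theorem tendsto_rescaled_gelu {ι : Type*} {l : Filter ι} {N : ι → ℕ} {u : ι → ℝ} {t : ℝ}
    (hN : Tendsto N l atTop) (ht : Tendsto u l (𝓝 t)) :
    Tendsto (fun i => -(gaussDensity (N i))⁻¹ * gelu (-(N i + (N i : ℝ)⁻¹ * u i))) l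
      (𝓝 (Real.exp (-t))) := by
  have hn : Tendsto (fun i => (N i : ℝ)) l atTop := tendsto_natCast_atTop_atTop.comp hN
  have hinv : Tendsto (fun i => (N i : ℝ)⁻¹) l (𝓝 0) := tendsto_inv_atTop_zero.comp hn
  have hsmall : Tendsto (fun i => (N i : ℝ)⁻¹ * u i) l (𝓝 0) := by
    simpa using hinv.mul ht
  have h1 := tendsto_mills_ratio.comp (hn.atTop_add hsmall)
  have h2 : Tendsto (fun i => Real.exp (-u i - ((N i : ℝ)⁻¹ * u i) ^ 2 / 2))
      l (𝓝 (Real.exp (-t))) := by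
    have := (Real.continuous_exp.tendsto _).comp (ht.neg.sub ((hsmall.pow 2).div_const 2))
    simpa [Function.comp_def] using this
  have h3 := h1.mul h2
  rw [one_mul] at h3
  refine h3.congr' ?_
  filter_upwards [hn.eventually_gt_atTop 0] with i hi
  set n : ℝ := (N i : ℝ)
  set x : ℝ := n + n⁻¹ * u i with hx
  have hpos := gaussDensity_pos x
  have hposn := gaussDensity_pos n
  -- The square (n + u/n)² = n² + 2u + (u/n)² turns the Gaussian quotient into an exponential of u
  -- with a vanishing correction.
  have hq : Real.exp (-u i - (n⁻¹ * u i) ^ 2 / 2) = gaussDensity x / gaussDensity n := by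
    rw [eq_div_iff hposn.ne', gaussDensity_eq, gaussDensity_eq, mul_left_comm, ← Real.exp_add]
    congr 2
    rw [hx]
    field_simp
    ring
  rw [hq]
  change x * cdf (gaussianReal 0 1) (-x) / gaussDensity x * (gaussDensity x / gaussDensity n) =
    -(gaussDensity n)⁻¹ * (-x * cdf (gaussianReal 0 1) (-x))
  clear_value x n
  field_simp

/-- Multiplying the n-th difference by the scalar -1/φ(n) stays in `V` and turns GeLU into an
exponential in the limit. Differences are used because the space to which this is applied contains
only differences of hidden units. -/
theorem exp_sub_exp_mem_closure {X : Type*} [TopologicalSpace X] [CompactSpace X]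
    (V : Submodule ℝ C(X, ℝ)) (g h : C(X, ℝ))
    (hV : ∀ n : ℕ, ∃ w ∈ V, ∀ x, w x = gelu (-(n + (n : ℝ)⁻¹ * g x)) -
      gelu (-(n + (n : ℝ)⁻¹ * h x))) :
    ∃ w ∈ V.topologicalClosure, ∀ x, w x = Real.exp (-g x) - Real.exp (-h x) := by
  choose w hw hwx using hV
  obtain ⟨e, he⟩ : ∃ e : C(X, ℝ), ∀ x, e x = Real.exp (-g x) - Real.exp (-h x) :=
    ⟨⟨fun x => Real.exp (-g x) - Real.exp (-h x), by fun_prop⟩, fun _ => rfl⟩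
  refine ⟨e, ?_, he⟩
  have hmem : ∀ n : ℕ, -(gaussDensity n)⁻¹ • w n ∈ V := fun n => V.smul_mem _ (hw n)
  refine mem_closure_of_tendsto (b := atTop) (f := fun n : ℕ => -(gaussDensity n)⁻¹ • w n) ?_
    (Eventually.of_forall hmem)
  -- On a compact space uniform convergence to a continuous limit follows from joint convergence as
  -- n → ∞ and y → x, so the limit of the rescaled GeLU is needed only along moving arguments.
  rw [ContinuousMap.tendsto_iff_tendstoUniformly,
    ← tendstoLocallyUniformly_iff_tendstoUniformly_of_compactSpace,
    tendstoLocallyUniformly_iff_forall_tendsto]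
  intro x
  have key : ∀ g : C(X, ℝ), Tendsto (fun y : ℕ × X =>
      -(gaussDensity y.1)⁻¹ * gelu (-(y.1 + (y.1 : ℝ)⁻¹ * g y.2))) (atTop ×ˢ 𝓝 x)
      (𝓝 (Real.exp (-g x))) := by
    intro g
    exact tendsto_rescaled_gelu tendsto_fst ((g.continuous.tendsto x).comp tendsto_snd)
  have h1 := (key g).sub (key h)
  have h2 : Tendsto (fun y : ℕ × X => e y.2) (atTop ×ˢ 𝓝 x) (𝓝 (e x)) :=
    (e.continuous.tendsto x).comp tendsto_snd
  have h3 : Tendsto (fun y : ℕ × X => (-(gaussDensity y.1)⁻¹ • w y.1) y.2) (atTop ×ˢ 𝓝 x)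
      (𝓝 (e x)) := by
    rw [he]
    refine h1.congr fun y => ?_
    simp only [ContinuousMap.smul_apply, hwx, smul_eq_mul]
    ring
  exact Filter.Tendsto.mono_right (h2.prodMk_nhds h3) (nhds_le_uniformity (e x))

/-- The closure of an algebra of continuous functions on a compact space contains every continuous
function that does not separate more points than the algebra. -/
theorem mem_topologicalClosure_of_constant_on_fibres {X : Type*} [TopologicalSpace X]
    [CompactSpace X] (A : Subalgebra ℝ C(X, ℝ)) (F : C(X, ℝ))
    (hF : ∀ x y, (∀ a ∈ A, a x = a y) → F x = F y) : F ∈ A.topologicalClosure := by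
  -- Stone-Weierstrass is applied on the quotient by the joint fibres of `A`: both `A` and `F`
  -- descend to it, and there the algebra separates points.
  let r : Setoid X := ⟨fun x y => ∀ a ∈ A, a x = a y, fun _ _ _ => rfl,
    fun h a ha => (h a ha).symm, fun h h' a ha => (h a ha).trans (h' a ha)⟩
  let π : C(X, Quotient r) := ⟨Quotient.mk r, continuous_quotient_mk'⟩
  let c : C(Quotient r, ℝ) →ₐ[ℝ] C(X, ℝ) := ContinuousMap.compRightAlgHom ℝ ℝ π
  have hc : Continuous c := ContinuousMap.continuous_precomp π
  let B : Subalgebra ℝ C(Quotient r, ℝ) := A.comap c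
  let lift (G : C(X, ℝ)) (hG : ∀ x y, (∀ a ∈ A, a x = a y) → G x = G y) : C(Quotient r, ℝ) :=
    ⟨Quotient.lift G hG, G.continuous.quotient_lift hG⟩
  have hlift : ∀ G hG, c (lift G hG) = G := fun G hG => by ext x; rfl
  have hB : B.SeparatesPoints := by
    intro x y
    induction x using Quotient.inductionOn with | _ x
    induction y using Quotient.inductionOn with | _ y
    intro hxy
    have : ¬ ∀ a ∈ A, a x = a y := fun h => hxy (Quotient.sound h)
    push Not at this
    obtain ⟨a, ha, hne⟩ := this
    refine ⟨_, ⟨lift a fun x y h => h a ha, ?_, rfl⟩, hne⟩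
    change c _ ∈ A
    rwa [hlift]
  have hmem : lift F hF ∈ B.topologicalClosure := by
    rw [ContinuousMap.subalgebra_topologicalClosure_eq_top_of_separatesPoints B hB]
    trivial
  rw [← hlift F hF]
  have h2 : Set.MapsTo c (B : Set C(Quotient r, ℝ)) (A : Set C(X, ℝ)) := fun b hb => hb
  exact h2.closure hc hmem

end CoNO

namespace CoNO

open Filter Topology

/-! ### Characters and trigonometric polynomials -/

theorem character_zero (α : ℝ) (d : ℕ) : character α (0 : Fin d → ℤ) = 1 := by
  funext x; simp [character]

theorem character_add (α : ℝ) {d : ℕ} (k l : Fin d → ℤ) :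
    character α (k + l) = character α k * character α l := by
  funext x
  simp only [character, Pi.mul_apply, ← Complex.exp_add, ← add_mul, ← Complex.ofReal_add]
  congr 3
  simp only [Pi.add_apply, Int.cast_add, add_mul, Finset.sum_add_distrib]
  ring

theorem conj_character (α : ℝ) {d : ℕ} (k : Fin d → ℤ) (x : Fin d → ℝ) :
    (starRingEnd ℂ) (character α k x) = character α (-k) x := by
  simp only [character, ← Complex.exp_conj, map_mul, Complex.conj_ofReal, Complex.conj_I]
  congr 1
  simp [Finset.sum_neg_distrib]
  ring

theorem contDiff_character (α : ℝ) {d : ℕ} (k : Fin d → ℤ) {n : WithTop ℕ∞} :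
    ContDiff ℝ n (character α k : (Fin d → ℝ) → ℂ) := by
  have h : ContDiff ℝ n (fun x : Fin d → ℝ =>
      -2 * Real.pi * (∑ i, (k i : ℝ) * x i) / |Real.sin α|) := by fun_prop
  exact ((Complex.ofRealCLM.contDiff.comp h).mul contDiff_const).cexp

theorem continuous_character (α : ℝ) {d : ℕ} (k : Fin d → ℤ) :
    Continuous (character α k : (Fin d → ℝ) → ℂ) :=
  (contDiff_character α k (n := 0)).continuous

theorem norm_character (α : ℝ) {d : ℕ} (k : Fin d → ℤ) (x : Fin d → ℝ) :
    ‖character α k x‖ = 1 := by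
  unfold character
  rw [Complex.norm_exp_ofReal_mul_I]

/-- Complex trigonometric polynomials on the fractional torus. -/
def trigAlgebra (α : ℝ) (d : ℕ) : Subalgebra ℂ ((Fin d → ℝ) → ℂ) :=
  Algebra.adjoin ℂ (Set.range (character α))

/-- Products of characters are characters, so the algebra they generate is nothing more than their
linear span. -/
theorem trigAlgebra_toSubmodule (α : ℝ) (d : ℕ) :
    Subalgebra.toSubmodule (trigAlgebra α d) = Submodule.span ℂ (Set.range (character α)) := by
  refine Algebra.adjoin_eq_span_of_subset ℂ (Set.Subset.trans ?_ Submodule.subset_span)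
  intro f hf
  induction hf using Submonoid.closure_induction with
  | mem x hx => exact hx
  | one => exact ⟨0, character_zero α d⟩
  | mul x y _ _ hx hy =>
    obtain ⟨k, rfl⟩ := hx
    obtain ⟨l, rfl⟩ := hy
    exact ⟨k + l, character_add α k l⟩

/-- Real trigonometric polynomials on the fractional torus. -/
def realTrig (α : ℝ) (d : ℕ) : Subalgebra ℝ ((Fin d → ℝ) → ℝ) :=
  ((trigAlgebra α d).restrictScalars ℝ).comap (Complex.ofRealAm.compLeft (Fin d → ℝ))

theorem mem_realTrig {α : ℝ} {d : ℕ} {q : (Fin d → ℝ) → ℝ} :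
    q ∈ realTrig α d ↔ (fun x => (q x : ℂ)) ∈ Submodule.span ℂ (Set.range (character α)) := by
  rw [← trigAlgebra_toSubmodule]; rfl

theorem re_character_mem_realTrig (α : ℝ) {d : ℕ} (k : Fin d → ℤ) :
    (fun x : Fin d → ℝ => (character α k x).re) ∈ realTrig α d := by
  rw [mem_realTrig]
  have h : (fun x : Fin d → ℝ => ((character α k x).re : ℂ)) =
      (1 / 2 : ℂ) • (character α k + character α (-k)) := by
    funext x
    simp only [Pi.smul_apply, Pi.add_apply, ← conj_character, smul_eq_mul, Complex.add_conj,
      Complex.ofReal_mul, Complex.ofReal_ofNat]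
    ring
  rw [h]
  exact Submodule.smul_mem _ _ (Submodule.add_mem _ (Submodule.subset_span ⟨k, rfl⟩)
    (Submodule.subset_span ⟨-k, rfl⟩))

theorem im_character_mem_realTrig (α : ℝ) {d : ℕ} (k : Fin d → ℤ) :
    (fun x : Fin d → ℝ => (character α k x).im) ∈ realTrig α d := by
  rw [mem_realTrig]
  have h : (fun x : Fin d → ℝ => ((character α k x).im : ℂ)) =
      (1 / (2 * Complex.I) : ℂ) • (character α k - character α (-k)) := by
    funext x
    simp only [Pi.smul_apply, Pi.sub_apply, ← conj_character, smul_eq_mul, Complex.sub_conj,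
      Complex.ofReal_mul, Complex.ofReal_ofNat]
    field_simp
  rw [h]
  exact Submodule.smul_mem _ _ (Submodule.sub_mem _ (Submodule.subset_span ⟨k, rfl⟩)
    (Submodule.subset_span ⟨-k, rfl⟩))

/-- Real trigonometric polynomials are real combinations of cosines and sines. -/
theorem mem_span_of_mem_realTrig {α : ℝ} {d : ℕ} {q : (Fin d → ℝ) → ℝ} (hq : q ∈ realTrig α d) :
    q ∈ Submodule.span ℝ (Set.range (fun k x => (character α k x).re) ∪
      Set.range (fun k x => (character α k x).im)) := by
  rw [mem_realTrig, Finsupp.mem_span_range_iff_exists_finsupp] at hq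
  obtain ⟨c, hc⟩ := hq
  have h : q = ∑ k ∈ c.support, ((c k).re • (fun x => (character α k x).re) -
      (c k).im • (fun x => (character α k x).im)) := by
    funext x
    have := congrArg Complex.re (congrFun hc x)
    simp only [Finsupp.sum, Finset.sum_apply, Pi.smul_apply, smul_eq_mul, Complex.re_sum,
      Complex.mul_re, Complex.ofReal_re] at this
    simp [← this]
  rw [h]
  refine Submodule.sum_mem _ fun k _ => Submodule.sub_mem _ ?_ ?_
  · exact Submodule.smul_mem _ _ (Submodule.subset_span (Or.inl ⟨k, rfl⟩))
  · exact Submodule.smul_mem _ _ (Submodule.subset_span (Or.inr ⟨k, rfl⟩))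

theorem contDiff_of_mem_realTrig {α : ℝ} {d : ℕ} {q : (Fin d → ℝ) → ℝ} (hq : q ∈ realTrig α d)
    {n : WithTop ℕ∞} : ContDiff ℝ n q := by
  have := mem_span_of_mem_realTrig hq
  clear hq
  induction this using Submodule.span_induction with
  | mem f hf =>
    rcases hf with ⟨k, rfl⟩ | ⟨k, rfl⟩
    · exact Complex.reCLM.contDiff.comp (contDiff_character α k)
    · exact Complex.imCLM.contDiff.comp (contDiff_character α k)
  | zero => exact contDiff_const
  | add f g _ _ hf hg => exact hf.add hg
  | smul c f _ hf => exact contDiff_const.mul hf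

/-- The trigonometric polynomial `∏ j, sin(π x_j / |sin α|)^{2r}`, which vanishes to order `2r` on
the boundary of the cube. -/
def boundaryBump (α : ℝ) (d r : ℕ) (x : Fin d → ℝ) : ℝ :=
  ∏ j, Real.sin (Real.pi * x j / |Real.sin α|) ^ (2 * r)

/-- The exponent is even, and sin² = (1 - cos(2·))/2 doubles the frequency: the sine itself has only
half the frequency of a torus character. -/
theorem boundaryBump_mem_realTrig (α : ℝ) (d r : ℕ) : boundaryBump α d r ∈ realTrig α d := by
  have h : boundaryBump α d r = ∏ j, ((1 / 2 : ℝ) • (1 - fun x : Fin d → ℝ =>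
      (character α (Pi.single j 1) x).re)) ^ r := by
    funext x
    rw [boundaryBump, Finset.prod_apply]
    refine Finset.prod_congr rfl fun j _ => ?_
    have hs : ∑ i, ((Pi.single j 1 : Fin d → ℤ) i : ℝ) * x i = x j := by
      rw [Finset.sum_eq_single j (fun b _ hb => by simp [hb]) (by simp)]
      simp
    rw [pow_mul]
    simp only [Pi.pow_apply, Pi.smul_apply, Pi.sub_apply, Pi.one_apply, character, hs,
      Complex.exp_ofReal_mul_I_re, smul_eq_mul]
    congr 1
    rw [Real.sin_sq_eq_half_sub, ← Real.cos_neg (2 * _)]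
    rw [show -(2 * (Real.pi * x j / |Real.sin α|)) = -2 * Real.pi * x j / |Real.sin α| by ring]
    ring
  rw [h]
  exact Subalgebra.prod_mem _ fun j _ => Subalgebra.pow_mem _ (Subalgebra.smul_mem _
    (Subalgebra.sub_mem _ (Subalgebra.one_mem _) (re_character_mem_realTrig α _)) _) _

variable {α : ℝ} {d : ℕ}

theorem mem_Ioo_of_boundaryBump_ne_zero {r : ℕ} (hr : r ≠ 0) (hα : Real.sin α ≠ 0)
    {x : Fin d → ℝ} (hx : x ∈ cube α d) (h : boundaryBump α d r x ≠ 0) (j : Fin d) :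
    x j ∈ Set.Ioo 0 |Real.sin α| := by
  have hj : Real.sin (Real.pi * x j / |Real.sin α|) ≠ 0 := by
    intro h0
    exact h (Finset.prod_eq_zero (Finset.mem_univ j) (by rw [h0, zero_pow (by omega)]))
  refine ⟨lt_of_le_of_ne (hx.1 j) fun h0 => hj ?_, lt_of_le_of_ne (hx.2 j) fun h0 => hj ?_⟩
  · rw [← h0, mul_zero, zero_div, Real.sin_zero]
  · rw [h0, mul_div_assoc, div_self (abs_ne_zero.mpr hα), mul_one, Real.sin_pi]

theorem boundaryBump_pos {r : ℕ} {x : Fin d → ℝ} (hx : ∀ j, x j ∈ Set.Ioo 0 |Real.sin α|) :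
    0 < boundaryBump α d r x := by
  refine Finset.prod_pos fun j _ => pow_pos (Real.sin_pos_of_pos_of_lt_pi ?_ ?_) _
  · exact div_pos (mul_pos Real.pi_pos (hx j).1) ((hx j).1.trans (hx j).2)
  · rw [div_lt_iff₀ ((hx j).1.trans (hx j).2)]
    exact mul_lt_mul_of_pos_left (hx j).2 Real.pi_pos

theorem ae_torusMeasure_mem_Ioo :
    ∀ᵐ x ∂torusMeasure α d, ∀ j, x j ∈ Set.Ioo 0 |Real.sin α| := by
  have h1 : (Set.univ.pi fun _ => Set.Ioo 0 |Real.sin α|) =ᵐ[volume] cube α d :=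
    Measure.univ_pi_Ioo_ae_eq_Icc (f := 0) (g := fun _ : Fin d => |Real.sin α|)
  rw [torusMeasure, ← Measure.restrict_congr_set h1]
  filter_upwards [ae_restrict_mem (MeasurableSet.univ_pi fun _ => measurableSet_Ioo)] with x hx j
  exact hx j (Set.mem_univ j)

/-- In the interior of the cube the trigonometric polynomials separate points. -/
theorem eq_of_forall_realTrig {x y : Fin d → ℝ} (hα : Real.sin α ≠ 0)
    (hx : ∀ j, x j ∈ Set.Ioo 0 |Real.sin α|) (hy : y ∈ cube α d)
    (h : ∀ q ∈ realTrig α d, q x = q y) : x = y := by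
  have hpos : 0 < |Real.sin α| := abs_pos.mpr hα
  -- The bump is positive at x, hence nonzero at y, so y too is an interior point.
  have hb := h _ (boundaryBump_mem_realTrig α d 1)
  have hy' := mem_Ioo_of_boundaryBump_ne_zero one_ne_zero hα hy
    (hb ▸ (boundaryBump_pos hx).ne')
  funext j
  have hc : character α (Pi.single j 1) x = character α (Pi.single j 1) y :=
    Complex.ext (h _ (re_character_mem_realTrig α _)) (h _ (im_character_mem_realTrig α _))
  have hs : ∀ x : Fin d → ℝ, ∑ i, ((Pi.single j 1 : Fin d → ℤ) i : ℝ) * x i = x j := by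
    intro x
    rw [Finset.sum_eq_single j (fun b _ hb => by simp [hb]) (by simp)]
    simp
  simp only [character, hs, Complex.exp_eq_exp_iff_exists_int] at hc
  obtain ⟨n, hn⟩ := hc
  have hn' : -2 * Real.pi * x j / |Real.sin α| =
      -2 * Real.pi * y j / |Real.sin α| + n * (2 * Real.pi) := by
    have := congrArg Complex.im hn
    simpa using this
  have hxy : x j = y j - n * |Real.sin α| := by
    have := Real.pi_pos.ne'
    field_simp at hn'
    linarith
  have h1 := hx j
  have h2 := hy' j
  -- The characters fix each coordinate modulo |sin α|, and two points of the open interval of that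
  -- length differ by less than a period.
  have hn0 : n = 0 := by
    have ha : (n : ℝ) < 1 := by
      by_contra hcon
      push Not at hcon
      nlinarith [h1.1, h2.2, mul_le_mul_of_nonneg_right hcon hpos.le]
    have hb : (-1 : ℝ) < n := by
      by_contra hcon
      push Not at hcon
      nlinarith [h1.2, h2.1, mul_le_mul_of_nonneg_right hcon hpos.le]
    have ha' : n < 1 := by exact_mod_cast ha
    have hb' : -1 < n := by exact_mod_cast hb
    omega
  simpa [hn0] using hxy

/-! ### Completeness of the characters -/

theorem integral_trig_mul_eq_zero {w : (Fin d → ℝ) → ℂ} (hw : Integrable w (torusMeasure α d))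
    (h : ∀ k, ∫ x, character α k x * w x ∂torusMeasure α d = 0) {q : (Fin d → ℝ) → ℝ}
    (hq : q ∈ realTrig α d) : ∫ x, (q x : ℂ) * w x ∂torusMeasure α d = 0 := by
  rw [mem_realTrig] at hq
  have key : ∀ f ∈ Submodule.span ℂ (Set.range (character α (d := d))),
      Integrable (fun x => f x * w x) (torusMeasure α d) ∧
        ∫ x, f x * w x ∂torusMeasure α d = 0 := by
    intro f hf
    induction hf using Submodule.span_induction with
    | mem f hf =>
      obtain ⟨k, rfl⟩ := hf
      exact ⟨hw.bdd_mul (c := 1) (continuous_character α k).aestronglyMeasurable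
        (Eventually.of_forall fun x => (norm_character α k x).le), h k⟩
    | zero => simp
    | add f g _ _ hf hg =>
      simp only [Pi.add_apply, add_mul]
      exact ⟨hf.1.add hg.1, by rw [integral_add hf.1 hg.1, hf.2, hg.2, add_zero]⟩
    | smul c f _ hf =>
      simp only [Pi.smul_apply, smul_eq_mul, mul_assoc]
      exact ⟨hf.1.const_mul c, by rw [integral_const_mul, hf.2, mul_zero]⟩
  exact (key _ hq).2

instance : CompactSpace (cube α d) := isCompact_iff_compactSpace.mp isCompact_Icc

/-- The restrictions of the real trigonometric polynomials to the cube. -/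
def trigOnCube (α : ℝ) (d : ℕ) : Subalgebra ℝ C(cube α d, ℝ) where
  carrier := {F | ∃ q ∈ realTrig α d, ∀ x, F x = q x}
  mul_mem' := by
    rintro F G ⟨q, hq, hF⟩ ⟨p, hp, hG⟩
    exact ⟨q * p, Subalgebra.mul_mem _ hq hp, fun x => by simp [hF, hG]⟩
  add_mem' := by
    rintro F G ⟨q, hq, hF⟩ ⟨p, hp, hG⟩
    exact ⟨q + p, Subalgebra.add_mem _ hq hp, fun x => by simp [hF, hG]⟩
  algebraMap_mem' c := ⟨algebraMap ℝ _ c, Subalgebra.algebraMap_mem _ c, fun x => rfl⟩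

theorem measurableSet_cube : MeasurableSet (cube α d) := measurableSet_Icc

/-- Integration against w is a continuous functional on C(cube) that kills the trigonometric
polynomials, hence their uniform closure. That closure contains every smooth function compactly
supported in the open cube: such a function vanishes on the boundary, the only place where
trigonometric polynomials identify distinct points. The fundamental lemma of the calculus of
variations then gives w = 0. -/
theorem ae_eq_zero_of_integral_character_eq_zero (hα : Real.sin α ≠ 0) {w : (Fin d → ℝ) → ℂ}
    (hw : Integrable w (torusMeasure α d))
    (h : ∀ k, ∫ x, character α k x * w x ∂torusMeasure α d = 0) :
    w =ᵐ[torusMeasure α d] 0 := by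
  set U : Set (Fin d → ℝ) := Set.univ.pi fun _ => Set.Ioo 0 |Real.sin α| with hU
  have hUo : IsOpen U := isOpen_set_pi Set.finite_univ fun _ _ => isOpen_Ioo
  have hUc : U ⊆ cube α d := fun x hx =>
    ⟨fun j => (hx j (Set.mem_univ j)).1.le, fun j => (hx j (Set.mem_univ j)).2.le⟩
  let μ : Measure (cube α d) := Measure.comap Subtype.val volume
  have hwμ : Integrable (fun x : cube α d => w x) μ :=
    (integrableOn_iff_comap_subtypeVal measurableSet_cube).mp hw
  have hint : ∀ f : (Fin d → ℝ) → ℂ, ∫ x : cube α d, f x ∂μ = ∫ x, f x ∂torusMeasure α d :=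
    fun f => integral_subtype_comap measurableSet_cube f
  have hFi : ∀ F : C(cube α d, ℝ), Integrable (fun x => (F x : ℂ) * w x) μ := fun F =>
    hwμ.bdd_mul (c := ‖F‖) (by fun_prop : Continuous fun x => (F x : ℂ)).aestronglyMeasurable
      (Eventually.of_forall fun x => by
        rw [Complex.norm_real]
        exact F.norm_coe_le_norm x)
  let Λ : C(cube α d, ℝ) →L[ℝ] ℂ := LinearMap.mkContinuous
    { toFun := fun F => ∫ x, (F x : ℂ) * w x ∂μ
      map_add' := fun F G => by
        rw [← integral_add (hFi F) (hFi G)]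
        simp [add_mul]
      map_smul' := fun c F => by
        simp only [ContinuousMap.smul_apply, smul_eq_mul, Complex.ofReal_mul, mul_assoc,
          RingHom.id_apply, Complex.real_smul]
        rw [integral_const_mul] } (∫ x, ‖w x‖ ∂μ) (fun F => by
      change ‖∫ x, (F x : ℂ) * w x ∂μ‖ ≤ _
      rw [mul_comm, ← integral_const_mul]
      refine norm_integral_le_of_norm_le (hwμ.norm.const_mul _) (Eventually.of_forall fun x => ?_)
      rw [norm_mul, Complex.norm_real]
      exact mul_le_mul_of_nonneg_right (F.norm_coe_le_norm x) (norm_nonneg _))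
  have hΛ : ∀ F ∈ trigOnCube α d, Λ F = 0 := by
    rintro F ⟨q, hq, hF⟩
    change ∫ x, (F x : ℂ) * w x ∂μ = 0
    simp only [hF]
    exact (hint fun x => (q x : ℂ) * w x).trans (integral_trig_mul_eq_zero hw h hq)
  have hΛ' : ∀ F ∈ (trigOnCube α d).topologicalClosure, Λ F = 0 := by
    intro F hF
    have hcl : IsClosed {F | Λ F = 0} := isClosed_eq Λ.continuous continuous_const
    exact closure_minimal (fun F hF => hΛ F hF) hcl hF
  have hmain : ∀ᵐ x ∂volume, x ∈ U → w x = 0 := by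
    refine hUo.ae_eq_zero_of_integral_contDiff_smul_eq_zero ?_ fun g hg _ hgU => ?_
    · exact (IntegrableOn.mono_set hw hUc).locallyIntegrableOn
    have hg0 : ∀ x, x ∉ U → g x = 0 := fun x hx =>
      image_eq_zero_of_notMem_tsupport fun hx' => hx (hgU hx')
    let F : C(cube α d, ℝ) := ⟨fun x => g x, hg.continuous.comp continuous_subtype_val⟩
    have hF : F ∈ (trigOnCube α d).topologicalClosure := by
      refine mem_topologicalClosure_of_constant_on_fibres _ _ fun x y hxy => ?_
      have hq : ∀ q ∈ realTrig α d, q x = q y := fun q hq =>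
        hxy ⟨fun x => q x, (contDiff_of_mem_realTrig hq (n := 0)).continuous.comp
          continuous_subtype_val⟩ ⟨q, hq, fun _ => rfl⟩
      change g x = g y
      by_cases hx : (x : Fin d → ℝ) ∈ U
      · rw [eq_of_forall_realTrig hα (fun j => hx j (Set.mem_univ j)) y.2 hq]
      by_cases hy : (y : Fin d → ℝ) ∈ U
      · rw [eq_of_forall_realTrig hα (fun j => hy j (Set.mem_univ j)) x.2
          fun q hq' => (hq q hq').symm]
      rw [hg0 x hx, hg0 y hy]
    have h0 : ∫ x, (g x : ℂ) * w x ∂torusMeasure α d = 0 :=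
      (hint fun x => (g x : ℂ) * w x).symm.trans (hΛ' F hF)
    rw [torusMeasure, setIntegral_eq_integral_of_forall_compl_eq_zero] at h0
    · simpa only [Complex.real_smul] using h0
    · intro x hx
      rw [hg0 x fun hx' => hx (hUc hx')]
      simp
  have hU' : U =ᵐ[volume] cube α d :=
    Measure.univ_pi_Ioo_ae_eq_Icc (f := 0) (g := fun _ : Fin d => |Real.sin α|)
  rw [torusMeasure, ← Measure.restrict_congr_set hU']
  exact (ae_restrict_iff' hUo.measurableSet).mpr hmain

end CoNO

namespace CoNO

open Filter Topology

variable {α : ℝ} {d n : ℕ}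

/-! ### Parseval's identity -/

theorem torusMeasure_eq_pi :
    torusMeasure α d = Measure.pi fun _ => volume.restrict (Set.Icc 0 |Real.sin α|) := by
  rw [torusMeasure, cube, ← Measure.restrict_pi_pi, ← volume_pi, Set.pi_univ_Icc]
  rfl

theorem character_eq_prod (k : Fin d → ℤ) (x : Fin d → ℝ) :
    character α k x =
      ∏ j, Complex.exp ((-2 * Real.pi * k j / |Real.sin α| : ℝ) * Complex.I * x j) := by
  rw [character, ← Complex.exp_sum]
  congr 1
  rw [Finset.mul_sum, Finset.sum_div, Complex.ofReal_sum, Finset.sum_mul]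
  refine Finset.sum_congr rfl fun j _ => ?_
  push_cast
  ring

theorem integral_exp_Icc_eq_zero (hα : Real.sin α ≠ 0) {m : ℤ} (hm : m ≠ 0) :
    ∫ t in Set.Icc 0 |Real.sin α|,
      Complex.exp ((-2 * Real.pi * m / |Real.sin α| : ℝ) * Complex.I * (t : ℝ)) = 0 := by
  have hpos : 0 < |Real.sin α| := abs_pos.mpr hα
  have hc : ((-2 * Real.pi * m / |Real.sin α| : ℝ) * Complex.I : ℂ) ≠ 0 := by
    have : (m : ℝ) ≠ 0 := by exact_mod_cast hm
    refine mul_ne_zero (Complex.ofReal_ne_zero.mpr ?_) Complex.I_ne_zero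
    have := Real.pi_pos
    positivity
  rw [integral_Icc_eq_integral_Ioc, ← intervalIntegral.integral_of_le hpos.le,
    integral_exp_mul_complex hc]
  have h1 : ((-2 * Real.pi * m / |Real.sin α| : ℝ) * Complex.I : ℂ) * (|Real.sin α| : ℝ) =
      ((-m : ℤ) : ℂ) * (2 * Real.pi * Complex.I) := by
    have : ((|Real.sin α| : ℝ) : ℂ) ≠ 0 := Complex.ofReal_ne_zero.mpr hpos.ne'
    push_cast
    field_simp
  rw [h1, Complex.exp_int_mul_two_pi_mul_I]
  simp

theorem integral_character (hα : Real.sin α ≠ 0) (k : Fin d → ℤ) :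
    ∫ x, character α k x ∂torusMeasure α d =
      if k = 0 then ((|Real.sin α| ^ d : ℝ) : ℂ) else 0 := by
  simp only [character_eq_prod]
  rw [torusMeasure_eq_pi, integral_fintype_prod_eq_prod (𝕜 := ℂ)
    (f := fun j (t : ℝ) => Complex.exp ((-2 * Real.pi * k j / |Real.sin α| : ℝ) * Complex.I * t))]
  split_ifs with h
  · subst h
    simp
  · obtain ⟨j, hj⟩ := Function.ne_iff.mp h
    exact Finset.prod_eq_zero (Finset.mem_univ j) (integral_exp_Icc_eq_zero hα hj)

theorem memLp_character (k : Fin d → ℤ) : MemLp (character α k) 2 (torusMeasure α d) :=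
  MemLp.of_bound (continuous_character α k).aestronglyMeasurable 1
    (Eventually.of_forall fun x => (norm_character α k x).le)

/-- The normalized characters in `L²`. -/
def characterLp (α : ℝ) (d : ℕ) (k : Fin d → ℤ) : Lp ℂ 2 (torusMeasure α d) :=
  (((√(|Real.sin α| ^ d))⁻¹ : ℝ) : ℂ) • (memLp_character (-k)).toLp

/-- The inner product conjugates its first argument; this is why `characterLp` is built on the
frequency -k. -/
theorem inner_characterLp (k : Fin d → ℤ) (f : Lp ℂ 2 (torusMeasure α d)) :
    inner ℂ (characterLp α d k) f =
      (((√(|Real.sin α| ^ d))⁻¹ : ℝ) : ℂ) * ∫ x, character α k x * f x ∂torusMeasure α d := by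
  rw [characterLp, inner_smul_left, Complex.conj_ofReal, L2.inner_def]
  congr 1
  refine integral_congr_ae ?_
  filter_upwards [MemLp.coeFn_toLp (memLp_character (α := α) (-k))] with x hx
  rw [hx, RCLike.inner_apply, conj_character, neg_neg, mul_comm]

theorem orthonormal_characterLp (hα : Real.sin α ≠ 0) : Orthonormal ℂ (characterLp α d) := by
  rw [orthonormal_iff_ite]
  intro k l
  have hpos : 0 < |Real.sin α| ^ d := pow_pos (abs_pos.mpr hα) d
  have h : ∫ x, character α k x * characterLp α d l x ∂torusMeasure α d =
      (((√(|Real.sin α| ^ d))⁻¹ : ℝ) : ℂ) * ∫ x, character α (k - l) x ∂torusMeasure α d := by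
    rw [← integral_const_mul]
    refine integral_congr_ae ?_
    filter_upwards [MemLp.coeFn_toLp (memLp_character (α := α) (-l)),
      Lp.coeFn_smul ((((√(|Real.sin α| ^ d))⁻¹ : ℝ) : ℂ)) (memLp_character (α := α) (-l)).toLp]
      with x hx hx'
    rw [characterLp, hx', Pi.smul_apply, hx, sub_eq_add_neg, character_add, Pi.mul_apply,
      smul_eq_mul]
    ring
  rw [inner_characterLp, h, integral_character hα]
  by_cases hkl : k = l
  · rw [if_pos (sub_eq_zero.mpr hkl), if_pos hkl, ← mul_assoc, ← Complex.ofReal_mul,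
      ← Complex.ofReal_mul, ← mul_inv, Real.mul_self_sqrt hpos.le, inv_mul_cancel₀ hpos.ne',
      Complex.ofReal_one]
  · rw [if_neg (sub_ne_zero.mpr hkl), if_neg hkl, mul_zero, mul_zero]

theorem span_characterLp_orthogonal (hα : Real.sin α ≠ 0) :
    (Submodule.span ℂ (Set.range (characterLp α d)))ᗮ = ⊥ := by
  rw [Submodule.eq_bot_iff]
  intro f hf
  rw [Submodule.mem_orthogonal] at hf
  have hpos : 0 < |Real.sin α| ^ d := pow_pos (abs_pos.mpr hα) d
  refine Lp.eq_zero_iff_ae_eq_zero.mpr (ae_eq_zero_of_integral_character_eq_zero hα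
    ((Lp.memLp f).integrable one_le_two) fun k => ?_)
  have h := hf _ (Submodule.subset_span ⟨k, rfl⟩)
  rw [inner_characterLp] at h
  refine (mul_eq_zero.mp h).resolve_left (Complex.ofReal_ne_zero.mpr ?_)
  exact inv_ne_zero (Real.sqrt_pos.mpr hpos).ne'

/-- Parseval's identity on the fractional torus. -/
theorem hasSum_norm_integral_character_sq (hα : Real.sin α ≠ 0)
    (f : Lp ℂ 2 (torusMeasure α d)) :
    HasSum (fun k => ‖∫ x, character α k x * f x ∂torusMeasure α d‖ ^ 2)
      (|Real.sin α| ^ d * ‖f‖ ^ 2) := by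
  have hpos : 0 < |Real.sin α| ^ d := pow_pos (abs_pos.mpr hα) d
  let b := HilbertBasis.mkOfOrthogonalEqBot (orthonormal_characterLp (d := d) hα)
    (span_characterLp_orthogonal hα)
  have h := lp.hasSum_norm (p := 2) (by norm_num) (b.repr f)
  rw [LinearIsometryEquiv.norm_map] at h
  simp only [b.repr_apply_apply] at h
  have hb : ∀ k, b k = characterLp α d k := fun k =>
    congrFun (HilbertBasis.coe_mkOfOrthogonalEqBot _ _) k
  simp only [hb, inner_characterLp, norm_mul, Complex.norm_real, norm_inv,
    ENNReal.toReal_ofNat, Real.rpow_ofNat, mul_pow, inv_pow] at h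
  have h2 := h.mul_left (|Real.sin α| ^ d)
  refine h2.congr_fun ?_
  intro k
  rw [Real.norm_eq_abs, sq_abs, Real.sq_sqrt hpos.le, ← mul_assoc, mul_inv_cancel₀ hpos.ne',
    one_mul]

/-! ### Parseval's identity for vector fields and the Sobolev norms -/

theorem memLp_coord (v : L2Space α d n) (j : Fin n) :
    MemLp (fun x => ((v x j : ℝ) : ℂ)) 2 (torusMeasure α d) := by
  have h : MemLp (fun x => v x j) 2 (torusMeasure α d) :=
    (EuclideanSpace.proj (𝕜 := ℝ) j).comp_memLp' (Lp.memLp v)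
  exact h.ofReal

/-- A component of an `L²` vector field as a complex `L²` function. -/
def coordLp (v : L2Space α d n) (j : Fin n) : Lp ℂ 2 (torusMeasure α d) :=
  (memLp_coord v j).toLp

theorem norm_sq_eq_sum_coordLp (v : L2Space α d n) : ‖v‖ ^ 2 = ∑ j, ‖coordLp v j‖ ^ 2 := by
  have h1 : ∀ {E : Type} [NormedAddCommGroup E] [InnerProductSpace ℝ E]
      (f : Lp E 2 (torusMeasure α d)), ‖f‖ ^ 2 = ∫ x, ‖f x‖ ^ 2 ∂torusMeasure α d := by
    intro E _ _ f
    rw [← real_inner_self_eq_norm_sq, L2.inner_def]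
    simp only [real_inner_self_eq_norm_sq]
  rw [h1]
  simp only [h1, EuclideanSpace.norm_sq_eq]
  rw [integral_finsetSum]
  · refine Finset.sum_congr rfl fun j _ => integral_congr_ae ?_
    filter_upwards [MemLp.coeFn_toLp (memLp_coord v j)] with x hx
    rw [coordLp, hx, Complex.norm_real]
  · intro j _
    simpa using (memLp_coord v j).integrable_norm_pow two_ne_zero

theorem fourierCoeff_apply (v : L2Space α d n) (k : Fin d → ℤ) (j : Fin n) :
    fourierCoeff α v k j = ((|Real.sin α| ^ d : ℝ) : ℂ)⁻¹ *
      ∫ x, character α k x * coordLp v j x ∂torusMeasure α d := by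
  rw [fourierCoeff]
  refine congrArg (_ * ·) (integral_congr_ae ?_)
  filter_upwards [MemLp.coeFn_toLp (memLp_coord v j)] with x hx
  rw [coordLp, hx, mul_comm]

theorem hasSum_norm_fourierCoeff_sq (hα : Real.sin α ≠ 0) (v : L2Space α d n) :
    HasSum (fun k => ‖fourierCoeff α v k‖ ^ 2) ((|Real.sin α| ^ d)⁻¹ * ‖v‖ ^ 2) := by
  have hpos : 0 < |Real.sin α| ^ d := pow_pos (abs_pos.mpr hα) d
  have h := hasSum_sum (s := Finset.univ) fun j (_ : j ∈ Finset.univ) =>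
    (hasSum_norm_integral_character_sq hα (coordLp v j)).mul_left ((|Real.sin α| ^ d)⁻¹ ^ 2)
  have e1 : (|Real.sin α| ^ d)⁻¹ * ‖v‖ ^ 2 =
      ∑ j, (|Real.sin α| ^ d)⁻¹ ^ 2 * (|Real.sin α| ^ d * ‖coordLp v j‖ ^ 2) := by
    rw [norm_sq_eq_sum_coordLp, Finset.mul_sum]
    refine Finset.sum_congr rfl fun j _ => ?_
    field_simp
  rw [e1]
  refine h.congr_fun fun k => ?_
  rw [EuclideanSpace.norm_sq_eq]
  refine Finset.sum_congr rfl fun j _ => ?_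
  rw [fourierCoeff_apply, norm_mul, mul_pow, norm_inv, Complex.norm_real,
    Real.norm_of_nonneg hpos.le]

theorem one_le_weight (k : Fin d → ℤ) : 1 ≤ 1 + ∑ i, (k i : ℝ) ^ 2 :=
  le_add_of_nonneg_right (Finset.sum_nonneg fun _ _ => sq_nonneg _)

theorem norm_weightedCoeff (s : ℝ) (v : (Fin d → ℝ) → EuclideanSpace ℝ (Fin n))
    (k : Fin d → ℤ) :
    ‖weightedCoeff α s v k‖ = (1 + ∑ i, (k i : ℝ) ^ 2) ^ (s / 2) * ‖fourierCoeff α v k‖ := by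
  rw [weightedCoeff, norm_smul, Real.norm_of_nonneg]
  exact Real.rpow_nonneg (zero_le_one.trans (one_le_weight k)) _

/-- The inclusion of `H^s` in `L²` is bounded. -/
theorem Sobolev.norm_toL2_le {s : ℝ} (hs : 0 ≤ s) (hα : Real.sin α ≠ 0) (v : Sobolev α s d n) :
    ‖v.toL2‖ ≤ √(|Real.sin α| ^ d) * ‖v‖ := by
  have hpos : 0 < |Real.sin α| ^ d := pow_pos (abs_pos.mpr hα) d
  have h1 := hasSum_norm_fourierCoeff_sq hα v.toL2
  have h2 := lp.hasSum_norm (p := 2) (by norm_num) (Sobolev.toLittleL2 α s d n v)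
  simp only [ENNReal.toReal_ofNat, Real.rpow_ofNat] at h2
  have h3 : (|Real.sin α| ^ d)⁻¹ * ‖v.toL2‖ ^ 2 ≤ ‖v‖ ^ 2 := by
    refine hasSum_le (fun k => ?_) h1 h2
    change _ ≤ ‖weightedCoeff α s v.toL2 k‖ ^ 2
    rw [norm_weightedCoeff]
    refine pow_le_pow_left₀ (norm_nonneg _) (le_mul_of_one_le_left (norm_nonneg _) ?_) 2
    exact Real.one_le_rpow (one_le_weight k) (by linarith)
  refine abs_le_of_sq_le_sq' ?_ (by positivity) |>.2
  rw [mul_pow, Real.sq_sqrt hpos.le]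
  rwa [inv_mul_le_iff₀ hpos] at h3

theorem Sobolev.continuous_toL2 {s : ℝ} (hs : 0 ≤ s) (hα : Real.sin α ≠ 0) :
    Continuous (Sobolev.toL2 : Sobolev α s d n → L2Space α d n) := by
  let f : Sobolev α s d n →+ L2Space α d n :=
    { toFun := Sobolev.toL2, map_zero' := rfl, map_add' := fun _ _ => rfl }
  exact AddMonoidHomClass.continuous_of_bound f _ fun v => Sobolev.norm_toL2_le hs hα v

/-- A function is in `H^s` if its weighted Fourier coefficients are dominated by the Fourier
coefficients of an `L²` function. -/
theorem mem_sobolevSubmodule_of_le {s : ℝ} (hα : Real.sin α ≠ 0) (v : L2Space α d n)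
    (h : ∀ j, ∃ g : Lp ℂ 2 (torusMeasure α d), ∀ k : Fin d → ℤ,
      (1 + ∑ i, (k i : ℝ) ^ 2) ^ (s / 2) *
        ‖∫ x, character α k x * (v x j : ℂ) ∂torusMeasure α d‖ ≤
      ‖∫ x, character α k x * g x ∂torusMeasure α d‖) :
    v ∈ sobolevSubmodule α s d n := by
  choose g hg using h
  refine memℓp_gen ?_
  simp only [ENNReal.toReal_ofNat, Real.rpow_ofNat]
  have hpos : 0 < |Real.sin α| ^ d := pow_pos (abs_pos.mpr hα) d
  have hsum := (hasSum_sum (s := Finset.univ) fun j (_ : j ∈ Finset.univ) =>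
    (hasSum_norm_integral_character_sq hα (g j)).mul_left ((|Real.sin α| ^ d)⁻¹ ^ 2)).summable
  refine Summable.of_nonneg_of_le (fun k => sq_nonneg _) (fun k => ?_) hsum
  rw [norm_weightedCoeff, mul_pow, EuclideanSpace.norm_sq_eq, Finset.mul_sum]
  refine Finset.sum_le_sum fun j _ => ?_
  have h0 : 0 ≤ (1 + ∑ i, (k i : ℝ) ^ 2) ^ (s / 2) :=
    Real.rpow_nonneg (zero_le_one.trans (one_le_weight k)) _
  have h1 := pow_le_pow_left₀ (by positivity) (hg j k) 2
  simp only [fourierCoeff, norm_mul, norm_inv, Complex.norm_real, Real.norm_of_nonneg hpos.le]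
  simp only [mul_comm (character α k _)] at h1 ⊢
  rw [mul_pow] at h1 ⊢
  rw [mul_left_comm]
  exact mul_le_mul_of_nonneg_left h1 (by positivity)

end CoNO

namespace CoNO

open Filter Topology

variable {α : ℝ} {d n : ℕ}

/-! ### Functions that are flat at the boundary of the cube -/

theorem fderiv_character_single (k : Fin d → ℤ) (j : Fin d) (x : Fin d → ℝ) :
    fderiv ℝ (character α k) x (Pi.single j 1) =
      -((2 * Real.pi * k j / |Real.sin α| : ℝ) * Complex.I) * character α k x := by
  let l : (Fin d → ℝ) →L[ℝ] ℝ :=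
    (-2 * Real.pi / |Real.sin α|) • ∑ i, (k i : ℝ) • ContinuousLinearMap.proj i
  have hl : ∀ y : Fin d → ℝ, l y = -2 * Real.pi * (∑ i, (k i : ℝ) * y i) / |Real.sin α| := by
    intro y
    simp only [l, _root_.smul_apply, _root_.sum_apply,
      ContinuousLinearMap.proj_apply, smul_eq_mul]
    ring
  have h1 : HasFDerivAt (fun y : Fin d → ℝ => ((l y : ℝ) : ℂ) * Complex.I)
      ((Complex.ofRealCLM.comp l).smulRight Complex.I) x :=
    ((Complex.ofRealCLM.comp l).smulRight Complex.I).hasFDerivAt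
  have h2 : HasFDerivAt (character α k)
      (character α k x • (Complex.ofRealCLM.comp l).smulRight Complex.I) x := by
    have := h1.cexp
    simp only [hl] at this
    exact this
  rw [h2.fderiv]
  have hs : ∑ i, (k i : ℝ) * (Pi.single j 1 : Fin d → ℝ) i = k j := by
    rw [Finset.sum_eq_single j (fun b _ hb => by simp [hb]) (by simp)]
    simp
  simp only [_root_.smul_apply, ContinuousLinearMap.smulRight_apply,
    ContinuousLinearMap.comp_apply, hl, hs, Complex.ofRealCLM_apply, smul_eq_mul]
  push_cast
  ring

theorem hasCompactSupport_of_support_subset_cube {w : (Fin d → ℝ) → ℂ}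
    (hs : Function.support w ⊆ cube α d) : HasCompactSupport w :=
  HasCompactSupport.of_support_subset_isCompact isCompact_Icc hs

theorem integral_torusMeasure_of_support {w : (Fin d → ℝ) → ℂ}
    (hs : Function.support w ⊆ cube α d) (k : Fin d → ℤ) :
    ∫ x, character α k x * w x ∂torusMeasure α d = ∫ x, character α k x * w x := by
  rw [torusMeasure, setIntegral_eq_integral_of_forall_compl_eq_zero]
  intro x hx
  rw [Function.notMem_support.mp fun h => hx (hs h), mul_zero]

theorem support_fderiv_subset_cube {w : (Fin d → ℝ) → ℂ} (hs : Function.support w ⊆ cube α d)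
    (v : Fin d → ℝ) : Function.support (fun x => fderiv ℝ w x v) ⊆ cube α d := by
  intro x hx
  have h1 : x ∈ Function.support (fderiv ℝ w) := by
    intro h0
    apply hx
    simp [h0]
  exact closure_minimal hs isClosed_Icc (support_fderiv_subset ℝ h1)

/-- Integration by parts on all of ℝ^d. There are no boundary terms, because w is continuously
differentiable on the whole space and vanishes off the cube. -/
theorem integral_character_mul_fderiv {w : (Fin d → ℝ) → ℂ} (hw : ContDiff ℝ 1 w)
    (hs : Function.support w ⊆ cube α d) (k : Fin d → ℤ) (j : Fin d) :
    ∫ x, character α k x * fderiv ℝ w x (Pi.single j 1) ∂torusMeasure α d =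
      ((2 * Real.pi * k j / |Real.sin α| : ℝ) * Complex.I) *
        ∫ x, character α k x * w x ∂torusMeasure α d := by
  rw [integral_torusMeasure_of_support (support_fderiv_subset_cube hs _),
    integral_torusMeasure_of_support hs]
  have hint : ∀ g : (Fin d → ℝ) → ℂ, Continuous g → Function.support g ⊆ cube α d →
      Integrable fun x => character α k x * g x := by
    intro g hg hgs
    exact ((continuous_character α k).mul hg).integrable_of_hasCompactSupport
      (hasCompactSupport_of_support_subset_cube hgs).mul_left
  have hd := hw.continuous_fderiv_apply (one_ne_zero)
  have hd' : Continuous fun x => fderiv ℝ w x (Pi.single j 1) :=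
    hd.comp (continuous_id.prodMk continuous_const)
  rw [integral_mul_fderiv_eq_neg_fderiv_mul_of_integrable]
  · rw [← integral_neg, ← integral_const_mul]
    refine integral_congr_ae (Eventually.of_forall fun x => ?_)
    simp only [fderiv_character_single]
    ring
  · refine ((hint w hw.continuous hs).const_mul
      (-((2 * Real.pi * k j / |Real.sin α| : ℝ) * Complex.I))).congr
      (Eventually.of_forall fun x => ?_)
    simp only [fderiv_character_single]
    ring
  · exact hint _ hd' (support_fderiv_subset_cube hs _)
  · exact hint w hw.continuous hs
  · exact fun x _ => (contDiff_character α k (n := 1)).differentiable one_ne_zero x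
  · exact fun x _ => hw.differentiable one_ne_zero x

/-- The Fourier coefficients of a smooth function supported in the cube decay rapidly. -/
theorem exists_weight_mul_integral_eq (hα : Real.sin α ≠ 0) (M : ℕ) {w : (Fin d → ℝ) → ℂ}
    (hw : ContDiff ℝ (2 * M : ℕ) w) (hs : Function.support w ⊆ cube α d) :
    ∃ g : (Fin d → ℝ) → ℂ, Continuous g ∧ ∀ k : Fin d → ℤ,
      (((1 + ∑ i, (k i : ℝ) ^ 2) ^ M : ℝ) : ℂ) * ∫ x, character α k x * w x ∂torusMeasure α d =
        ∫ x, character α k x * g x ∂torusMeasure α d := by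
  induction M generalizing w with
  | zero => exact ⟨w, hw.continuous, fun k => by simp⟩
  | succ M ih =>
    let D (j : Fin d) (u : (Fin d → ℝ) → ℂ) (x : Fin d → ℝ) : ℂ := fderiv ℝ u x (Pi.single j 1)
    have hD : ∀ j (m : ℕ) (u : (Fin d → ℝ) → ℂ), ContDiff ℝ (m + 1 : ℕ) u →
        ContDiff ℝ m (D j u) := fun j m u hu =>
      (hu.fderiv_right (m := m) (by norm_cast)).clm_apply contDiff_const
    have hw2 : ContDiff ℝ (2 * M + 2 : ℕ) w := hw
    have h1 : ∀ j, ContDiff ℝ (2 * M + 1 : ℕ) (D j w) := fun j => hD j _ w hw2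
    have h2 : ∀ j, ContDiff ℝ (2 * M : ℕ) (D j (D j w)) := fun j => hD j _ _ (h1 j)
    have s1 : ∀ j, Function.support (D j w) ⊆ cube α d := fun j => support_fderiv_subset_cube hs _
    have s2 : ∀ j, Function.support (D j (D j w)) ⊆ cube α d := fun j =>
      support_fderiv_subset_cube (s1 j) _
    -- With this c, the operator 1 - cΔ multiplies the k-th Fourier coefficient by 1 + |k|²; each
    -- application costs two derivatives.
    set c : ℂ := (((|Real.sin α| / (2 * Real.pi)) ^ 2 : ℝ) : ℂ) with hc
    let u : (Fin d → ℝ) → ℂ := fun x => w x - ∑ j, c * D j (D j w) x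
    have hu : ContDiff ℝ (2 * M : ℕ) u :=
      (hw2.of_le (by norm_cast; omega)).sub (ContDiff.sum fun j _ => contDiff_const.mul (h2 j))
    have hz : ∀ {g : (Fin d → ℝ) → ℂ}, Function.support g ⊆ cube α d → ∀ x, x ∉ cube α d →
        g x = 0 := fun hg x hx => Function.notMem_support.mp fun h => hx (hg h)
    have hus : Function.support u ⊆ cube α d := by
      intro x hx
      by_contra hxc
      apply hx
      simp only [u]
      rw [hz hs x hxc, zero_sub, neg_eq_zero]
      exact Finset.sum_eq_zero fun j _ => by rw [hz (s2 j) x hxc, mul_zero]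
    obtain ⟨g, hg, hgk⟩ := ih hu hus
    refine ⟨g, hg, fun k => ?_⟩
    rw [← hgk k]
    have hint : ∀ g : (Fin d → ℝ) → ℂ, Continuous g →
        Integrable (fun x => character α k x * g x) (torusMeasure α d) := fun g hg =>
      (((continuous_character α k).mul hg).continuousOn.integrableOn_compact isCompact_Icc)
    have e1 : ∀ j, ∫ x, character α k x * D j (D j w) x ∂torusMeasure α d =
        ((2 * Real.pi * k j / |Real.sin α| : ℝ) * Complex.I) ^ 2 *
          ∫ x, character α k x * w x ∂torusMeasure α d := by
      intro j
      rw [integral_character_mul_fderiv ((h1 j).of_le (by norm_cast; omega)) (s1 j),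
        integral_character_mul_fderiv (hw2.of_le (by norm_cast; omega)) hs, ← mul_assoc, sq]
    have e2 : ∫ x, character α k x * u x ∂torusMeasure α d =
        ∫ x, character α k x * w x ∂torusMeasure α d -
          ∑ j, c * ∫ x, character α k x * D j (D j w) x ∂torusMeasure α d := by
      simp only [u, mul_sub, Finset.mul_sum]
      rw [integral_sub (hint _ hw.continuous), integral_finsetSum]
      · congr 1
        refine Finset.sum_congr rfl fun j _ => ?_
        rw [← integral_const_mul]
        simp only [mul_left_comm]
      · exact fun j _ => hint _ (continuous_const.mul (h2 j).continuous)
      · exact integrable_finsetSum _ fun j _ => hint _ (continuous_const.mul (h2 j).continuous)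
    have e3 : ∀ j : Fin d, c * ((2 * Real.pi * k j / |Real.sin α| : ℝ) * Complex.I) ^ 2 =
        -((k j : ℝ) ^ 2 : ℝ) := by
      intro j
      rw [hc, mul_pow, Complex.I_sq, mul_neg_one, mul_neg, ← Complex.ofReal_pow,
        ← Complex.ofReal_mul]
      congr 2
      have := abs_ne_zero.mpr hα
      have := Real.pi_pos.ne'
      field_simp
    rw [e2]
    simp only [e1, ← mul_assoc, e3]
    rw [← Finset.sum_mul, Finset.sum_neg_distrib, pow_succ]
    push_cast
    ring

/-- Powers of the sine arch, extended by zero. -/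
def sineArch (L : ℝ) (n : ℕ) : ℝ → ℝ :=
  (Set.Icc 0 L).indicator fun t => Real.sin (Real.pi * t / L) ^ n

theorem sineArch_of_mem {L t : ℝ} (n : ℕ) (ht : t ∈ Set.Icc 0 L) :
    sineArch L n t = Real.sin (Real.pi * t / L) ^ n := Set.indicator_of_mem ht _

theorem sineArch_of_notMem_Ioo {L t : ℝ} (hL : 0 < L) {n : ℕ} (hn : n ≠ 0)
    (ht : t ∉ Set.Ioo 0 L) : sineArch L n t = 0 := by
  by_cases h : t ∈ Set.Icc 0 L
  · rw [sineArch_of_mem n h]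
    have : t = 0 ∨ t = L := by
      by_contra! hcon
      exact ht ⟨lt_of_le_of_ne h.1 hcon.1.symm, lt_of_le_of_ne h.2 hcon.2⟩
    rcases this with rfl | rfl
    · simp [hn]
    · rw [mul_div_assoc, div_self hL.ne', mul_one, Real.sin_pi, zero_pow hn]
  · exact Set.indicator_of_notMem h _

/-- The derivative is computed separately within [0, L] and within the closure of its complement,
and the two agree at the endpoints. The exponent is at least 2 so that a positive power of the arch
survives differentiation and vanishes there. -/
theorem hasDerivAt_sineArch {L : ℝ} (hL : 0 < L) (n : ℕ) (t : ℝ) :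
    HasDerivAt (sineArch L (n + 2))
      ((n + 2) * (Real.pi / L) * Real.cos (Real.pi * t / L) * sineArch L (n + 1) t) t := by
  have hzero : ∀ m : ℕ, ∀ t, t ∈ Set.Iic 0 ∪ Set.Ici L → sineArch L (m + 1) t = 0 := by
    intro m t ht
    refine sineArch_of_notMem_Ioo hL m.succ_ne_zero fun h => ?_
    rcases ht with h' | h'
    · exact absurd h.1 (not_lt.mpr h')
    · exact absurd h.2 (not_lt.mpr h')
  have h1 : HasDerivWithinAt (sineArch L (n + 2))
      ((n + 2) * (Real.pi / L) * Real.cos (Real.pi * t / L) * sineArch L (n + 1) t)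
      (Set.Icc 0 L) t := by
    by_cases ht : t ∈ Set.Icc 0 L
    · have h0 : HasDerivAt (fun t => Real.pi * t / L) (Real.pi / L) t := by
        simpa using ((hasDerivAt_id t).const_mul Real.pi).div_const L
      have := (h0.sin.pow (n + 2)).hasDerivWithinAt (s := Set.Icc 0 L)
      refine (this.congr (fun x hx => sineArch_of_mem _ hx) (sineArch_of_mem _ ht)).congr_deriv ?_
      rw [sineArch_of_mem _ ht]
      push_cast
      ring
    -- Away from a closed set, any value is a derivative within that set.
    · exact HasFDerivWithinAt.of_notMem_closure (by rwa [isClosed_Icc.closure_eq])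
  have h2 : HasDerivWithinAt (sineArch L (n + 2))
      ((n + 2) * (Real.pi / L) * Real.cos (Real.pi * t / L) * sineArch L (n + 1) t)
      (Set.Iic 0 ∪ Set.Ici L) t := by
    by_cases ht : t ∈ Set.Iic 0 ∪ Set.Ici L
    · rw [hzero n t ht, mul_zero]
      exact (hasDerivWithinAt_const t _ (0 : ℝ)).congr (fun x hx => hzero (n + 1) x hx)
        (hzero (n + 1) t ht)
    · exact HasFDerivWithinAt.of_notMem_closure
        (by rwa [(isClosed_Iic.union isClosed_Ici).closure_eq])
  have hu : Set.Icc 0 L ∪ (Set.Iic 0 ∪ Set.Ici L) = Set.univ := by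
    ext x
    simp only [Set.mem_union, Set.mem_Icc, Set.mem_Iic, Set.mem_Ici, Set.mem_univ, iff_true]
    by_cases hx : x ≤ 0
    · exact Or.inr (Or.inl hx)
    · by_cases hx' : L ≤ x
      · exact Or.inr (Or.inr hx')
      · exact Or.inl ⟨(not_le.mp hx).le, (not_le.mp hx').le⟩
  have := h1.union h2
  rwa [hu, hasDerivWithinAt_univ] at this

/-- Each derivative lowers the power by one, and one power must remain for continuity at the
endpoints. -/
theorem contDiff_sineArch {L : ℝ} (hL : 0 < L) (m n : ℕ) (h : m < n) :
    ContDiff ℝ m (sineArch L n) := by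
  induction m generalizing n with
  | zero =>
    have hn : n ≠ 0 := by omega
    -- Clamping the argument to [0, L] exhibits the arch as a composition of continuous functions.
    have he : sineArch L n = fun t => Real.sin (Real.pi * (max 0 (min t L)) / L) ^ n := by
      funext t
      by_cases ht : t ∈ Set.Icc 0 L
      · rw [sineArch_of_mem n ht, min_eq_left ht.2, max_eq_right ht.1]
      · rw [sineArch_of_notMem_Ioo hL hn fun h => ht ⟨h.1.le, h.2.le⟩]
        rcases lt_or_ge t 0 with h0 | h0
        · rw [min_eq_left (h0.le.trans hL.le), max_eq_left h0.le]
          simp [hn]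
        · have : L < t := by
            by_contra hcon
            exact ht ⟨h0, not_lt.mp hcon⟩
          rw [min_eq_right this.le, max_eq_right hL.le, mul_div_assoc, div_self hL.ne', mul_one,
            Real.sin_pi, zero_pow hn]
    rw [he]
    exact contDiff_zero.mpr (by fun_prop)
  | succ m ih =>
    obtain ⟨n, rfl⟩ : ∃ n', n = n' + 2 := ⟨n - 2, by omega⟩
    push_cast
    rw [contDiff_succ_iff_deriv]
    refine ⟨fun t => (hasDerivAt_sineArch hL n t).differentiableAt, by simp, ?_⟩
    rw [show deriv (sineArch L (n + 2)) = fun t => _ from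
      funext fun t => (hasDerivAt_sineArch hL n t).deriv]
    exact ContDiff.mul (by fun_prop) (ih (n + 1) (by omega))

/-- The functions on the cube whose extension by zero is `m` times continuously differentiable. -/
def flatSubmodule (α : ℝ) (d m : ℕ) : Submodule ℝ ((Fin d → ℝ) → ℝ) where
  carrier := {w | ContDiff ℝ m ((cube α d).indicator w)}
  zero_mem' := by
    simp only [Set.mem_ofPred_eq]
    rw [Set.indicator_zero']
    exact contDiff_const
  add_mem' {v w} hv hw := by
    simp only [Set.mem_ofPred_eq] at *
    rw [Set.indicator_add']
    exact hv.add hw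
  smul_mem' c v hv := by
    simp only [Set.mem_ofPred_eq] at *
    rw [show (cube α d).indicator (c • v) = fun x => c • (cube α d).indicator v x by
      funext x
      by_cases hx : x ∈ cube α d <;> simp [hx]]
    exact contDiff_const.mul hv

theorem indicator_boundaryBump (r : ℕ) :
    (cube α d).indicator (boundaryBump α d r) =
      fun x => ∏ j, sineArch |Real.sin α| (2 * r) (x j) := by
  funext x
  by_cases hx : x ∈ cube α d
  · rw [Set.indicator_of_mem hx, boundaryBump]
    exact Finset.prod_congr rfl fun j _ => (sineArch_of_mem _ ⟨hx.1 j, hx.2 j⟩).symm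
  · rw [Set.indicator_of_notMem hx]
    obtain ⟨j, hj⟩ : ∃ j, x j ∉ Set.Icc 0 |Real.sin α| := by
      by_contra! hcon
      exact hx ⟨fun j => (hcon j).1, fun j => (hcon j).2⟩
    exact (Finset.prod_eq_zero (Finset.mem_univ j) (Set.indicator_of_notMem hj _)).symm

/-- Perturbing the argument of a smooth function by a multiple of the boundary bump changes it by a
function that is flat at the boundary. -/
theorem comp_add_sub_comp_mem_flatSubmodule (hα : Real.sin α ≠ 0) {f : ℝ → ℝ}
    (hf : ContDiff ℝ (⊤ : ℕ∞) f) {h : (Fin d → ℝ) → ℝ} (hh : ContDiff ℝ (⊤ : ℕ∞) h) {m r : ℕ}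
    (hm : m < 2 * r) (t : ℝ) :
    (fun x => f (h x + t * boundaryBump α d r x) - f (h x)) ∈ flatSubmodule α d m := by
  -- The cutoff moves onto the bump: where the extended bump is zero the two terms cancel. What
  -- remains is a composition of functions that are C^m on the whole space.
  have he : (cube α d).indicator (fun x => f (h x + t * boundaryBump α d r x) - f (h x)) =
      fun x => f (h x + t * ∏ j, sineArch |Real.sin α| (2 * r) (x j)) - f (h x) := by
    funext x
    rw [← congrFun (indicator_boundaryBump (α := α) r) x]
    by_cases hx : x ∈ cube α d
    · rw [Set.indicator_of_mem hx, Set.indicator_of_mem hx]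
    · rw [Set.indicator_of_notMem hx, Set.indicator_of_notMem hx, mul_zero, add_zero, sub_self]
  change ContDiff ℝ m _
  rw [he]
  have hle : ((m : ℕ) : WithTop ℕ∞) ≤ ((⊤ : ℕ∞) : WithTop ℕ∞) := by
    exact_mod_cast (le_top : (m : ℕ∞) ≤ ⊤)
  have hp : ContDiff ℝ m fun x : Fin d → ℝ => ∏ j, sineArch |Real.sin α| (2 * r) (x j) :=
    contDiff_prod fun j _ => (contDiff_sineArch (abs_pos.mpr hα) m _ hm).comp
      (contDiff_apply ℝ ℝ j)
  exact ((hf.of_le hle).comp ((hh.of_le hle).add (contDiff_const.mul hp))).sub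
    ((hf.of_le hle).comp (hh.of_le hle))

/-- Vector fields that are flat at the boundary belong to the Sobolev spaces. -/
theorem exists_sobolev_of_mem_flatSubmodule {s : ℝ} (hα : Real.sin α ≠ 0) {M : ℕ}
    (hs : s ≤ 2 * M) {w : (Fin d → ℝ) → EuclideanSpace ℝ (Fin n)}
    (hw : ∀ i, (fun x => w x i) ∈ flatSubmodule α d (2 * M)) :
    ∃ u : Sobolev α s d n, ⇑u.toL2 =ᵐ[torusMeasure α d] w := by
  set W : (Fin d → ℝ) → EuclideanSpace ℝ (Fin n) :=
    fun x => WithLp.toLp 2 fun i => (cube α d).indicator (fun x => w x i) x with hWdef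
  have hcd : ∀ i, ContDiff ℝ (2 * M : ℕ) ((cube α d).indicator (fun x => w x i)) := hw
  have hWc : Continuous W := by
    rw [hWdef]
    exact (PiLp.continuous_toLp 2 _).comp (continuous_pi fun i => (hcd i).continuous)
  have hWw : W =ᵐ[torusMeasure α d] w := by
    filter_upwards [ae_restrict_mem measurableSet_cube] with x hx
    ext i
    simp [hWdef, Set.indicator_of_mem hx]
  have hWLp : MemLp W 2 (torusMeasure α d) := by
    obtain ⟨C, hC⟩ := (isCompact_Icc : IsCompact (cube α d)).exists_bound_of_continuousOn
      hWc.continuousOn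
    exact MemLp.of_bound hWc.aestronglyMeasurable C ((ae_restrict_mem measurableSet_cube).mono hC)
  refine ⟨⟨hWLp.toLp, mem_sobolevSubmodule_of_le hα _ fun j => ?_⟩, ?_⟩
  · let z : (Fin d → ℝ) → ℂ := fun x => ((cube α d).indicator (fun x => w x j) x : ℝ)
    have hz : ContDiff ℝ (2 * M : ℕ) z := Complex.ofRealCLM.contDiff.comp (hcd j)
    have hzs : Function.support z ⊆ cube α d := by
      intro x hx
      by_contra hxc
      exact hx (by simp [z, Set.indicator_of_notMem hxc])
    obtain ⟨g, hg, hgk⟩ := exists_weight_mul_integral_eq hα M hz hzs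
    have hgLp : MemLp g 2 (torusMeasure α d) := by
      obtain ⟨C, hC⟩ := (isCompact_Icc : IsCompact (cube α d)).exists_bound_of_continuousOn
        hg.continuousOn
      exact MemLp.of_bound hg.aestronglyMeasurable C ((ae_restrict_mem measurableSet_cube).mono hC)
    refine ⟨hgLp.toLp, fun k => ?_⟩
    have e1 : ∫ x, character α k x * (hgLp.toLp : Lp ℂ 2 (torusMeasure α d)) x ∂torusMeasure α d =
        ∫ x, character α k x * g x ∂torusMeasure α d := by
      refine integral_congr_ae ?_
      filter_upwards [hgLp.coeFn_toLp] with x hx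
      rw [hx]
    have e2 : ∫ x, character α k x * ((hWLp.toLp : L2Space α d n) x j : ℂ) ∂torusMeasure α d =
        ∫ x, character α k x * z x ∂torusMeasure α d := by
      refine integral_congr_ae ?_
      filter_upwards [hWLp.coeFn_toLp] with x hx
      rw [hx]
    have h1 := one_le_weight k
    have h0 : (0 : ℝ) ≤ 1 + ∑ i, (k i : ℝ) ^ 2 := zero_le_one.trans h1
    rw [e1, e2, ← hgk k, norm_mul, Complex.norm_real, Real.norm_of_nonneg (pow_nonneg h0 M),
      ← Real.rpow_natCast]
    exact mul_le_mul_of_nonneg_right (Real.rpow_le_rpow_of_exponent_le h1 (by linarith))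
      (norm_nonneg _)
  · exact hWLp.coeFn_toLp.trans hWw

end CoNO

namespace CoNO

open Filter Topology

variable {α : ℝ} {d n : ℕ}

/-! ### The fractional Fourier coefficients -/

theorem chirp_ne_zero (α : ℝ) (x : Fin d → ℝ) : chirp α x ≠ 0 := Complex.exp_ne_zero _

theorem contDiff_chirp (α : ℝ) {m : WithTop ℕ∞} :
    ContDiff ℝ m (chirp α : (Fin d → ℝ) → ℂ) := by
  have h : ContDiff ℝ m (fun x : Fin d → ℝ => Real.pi * (∑ i, x i ^ 2) * Real.cot α) := by
    fun_prop
  exact ((Complex.ofRealCLM.contDiff.comp h).mul contDiff_const).cexp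

theorem contDiff_fracChar (α : ℝ) (k : Fin d → ℤ) {m : WithTop ℕ∞} :
    ContDiff ℝ m (fracChar α k : (Fin d → ℝ) → ℂ) := by
  have h : ContDiff ℝ m (fun x : Fin d → ℝ =>
      -2 * Real.pi * (∑ i, (k i : ℝ) * x i) / Real.sin α) := by fun_prop
  exact ((Complex.ofRealCLM.contDiff.comp h).mul contDiff_const).cexp

theorem contDiff_fracKernel (α : ℝ) (k : Fin d → ℤ) {m : WithTop ℕ∞} :
    ContDiff ℝ m (fracKernel α k : (Fin d → ℝ) → ℂ) :=
  ((contDiff_const.mul (contDiff_chirp α)).mul (contDiff_fracChar α k)).mul contDiff_const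

theorem continuous_fracKernel (α : ℝ) (k : Fin d → ℤ) :
    Continuous (fracKernel α k : (Fin d → ℝ) → ℂ) :=
  (contDiff_fracKernel α k (m := 0)).continuous

/-- The number 1 - i cot α has real part 1. -/
theorem fracAmplitude_ne_zero (α : ℝ) (d : ℕ) :
    ((1 - Complex.I * (Real.cot α : ℂ)) ^ (1 / 2 : ℂ)) ^ d ≠ 0 := by
  refine pow_ne_zero _ ?_
  rw [Ne, Complex.cpow_eq_zero_iff, not_and_or]
  refine Or.inl fun h => ?_
  have := congrArg Complex.re h
  rw [Complex.sub_re, Complex.I_mul_re, Complex.ofReal_im] at this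
  simp at this

theorem fracKernel_ne_zero (α : ℝ) (k : Fin d → ℤ) (x : Fin d → ℝ) : fracKernel α k x ≠ 0 :=
  mul_ne_zero (mul_ne_zero (mul_ne_zero (fracAmplitude_ne_zero α d) (chirp_ne_zero α x))
    (Complex.exp_ne_zero _)) (chirp_ne_zero α _)

/-- Up to a sign in the frequency, the characters in the fractional kernel are the ordinary ones. -/
theorem exists_fracChar_eq (α : ℝ) (k : Fin d → ℤ) :
    ∃ l : Fin d → ℤ, fracChar α l = character α k := by
  rcases le_total 0 (Real.sin α) with h | h
  · exact ⟨k, by funext x; rw [fracChar, character, abs_of_nonneg h]⟩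
  · refine ⟨-k, ?_⟩
    funext x
    rw [fracChar, character, abs_of_nonpos h]
    congr 3
    simp only [Pi.neg_apply, Int.cast_neg, neg_mul, Finset.sum_neg_distrib]
    rw [div_neg, ← neg_div]
    ring

/-- The fractional Fourier coefficient of the `j`-th component of a real vector field. -/
def fracCoeff (v : L2Space α d n) (k : Fin d → ℤ) (j : Fin n) : ℂ :=
  ∫ x, ((v x j : ℝ) : ℂ) * fracKernel α k x ∂torusMeasure α d

/-- The coefficient is the L² inner product with the conjugate kernel, which is bounded on the cube.
-/
theorem continuous_fracCoeff (k : Fin d → ℤ) (j : Fin n) :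
    Continuous fun v : L2Space α d n => fracCoeff v k j := by
  let T : EuclideanSpace ℝ (Fin n) →L[ℝ] ℂ :=
    Complex.ofRealCLM.comp (EuclideanSpace.proj (𝕜 := ℝ) j)
  have hc : Continuous fun x : Fin d → ℝ => (starRingEnd ℂ) (fracKernel α k x) :=
    Complex.continuous_conj.comp (continuous_fracKernel α k)
  have hK : MemLp (fun x : Fin d → ℝ => (starRingEnd ℂ) (fracKernel α k x)) 2
      (torusMeasure α d) := by
    obtain ⟨C, hC⟩ := (isCompact_Icc : IsCompact (cube α d)).exists_bound_of_continuousOn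
      hc.continuousOn
    exact MemLp.of_bound hc.aestronglyMeasurable C ((ae_restrict_mem measurableSet_cube).mono hC)
  have h : (fun v : L2Space α d n => fracCoeff v k j) =
      fun v => inner ℂ hK.toLp (T.compLp v) := by
    funext v
    rw [L2.inner_def, fracCoeff]
    refine integral_congr_ae ?_
    filter_upwards [hK.coeFn_toLp, T.coeFn_compLp v] with x hx hx'
    rw [hx, hx', RCLike.inner_apply, starRingEnd_self_apply]
    rfl
  rw [h]
  exact continuous_const.inner (T.compLpL 2 (torusMeasure α d)).continuous

/-- Up to a nonzero factor independent of x, the fractional coefficients of v are the ordinary ones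
of chirp · v. Completeness of the characters applies, and the chirp, having no zeros, can be
cancelled. -/
theorem eq_of_fracCoeff_eq (hα : Real.sin α ≠ 0) {v w : L2Space α d n}
    (h : ∀ k j, fracCoeff v k j = fracCoeff w k j) : v = w := by
  have hj : ∀ j, ∀ᵐ x ∂torusMeasure α d, v x j = w x j := by
    intro j
    have hbd : ∃ C, ∀ᵐ x ∂torusMeasure α d, ‖chirp α x‖ ≤ C := by
      obtain ⟨C, hC⟩ := (isCompact_Icc : IsCompact (cube α d)).exists_bound_of_continuousOn
        (contDiff_chirp α (m := 0)).continuous.continuousOn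
      exact ⟨C, (ae_restrict_mem measurableSet_cube).mono hC⟩
    obtain ⟨C, hC⟩ := hbd
    have hi : ∀ v : L2Space α d n, Integrable (fun x => chirp α x * (v x j : ℂ))
        (torusMeasure α d) := fun v =>
      ((memLp_coord v j).integrable one_le_two).bdd_mul
        (contDiff_chirp α (m := 0)).continuous.aestronglyMeasurable hC
    have key := ae_eq_zero_of_integral_character_eq_zero hα ((hi v).sub (hi w)) fun k => by
      obtain ⟨l, hl⟩ := exists_fracChar_eq α k
      have hci : ∀ v : L2Space α d n,
          Integrable (fun x => character α k x * (chirp α x * (v x j : ℂ)))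
            (torusMeasure α d) := fun v =>
        (hi v).bdd_mul (c := 1) (continuous_character α k).aestronglyMeasurable
          (Eventually.of_forall fun x => (norm_character α k x).le)
      have hv : ∀ v : L2Space α d n, fracCoeff v l j =
          (((1 - Complex.I * (Real.cot α : ℂ)) ^ (1 / 2 : ℂ)) ^ d *
            chirp α (fun i => (l i : ℝ))) *
            ∫ x, character α k x * (chirp α x * (v x j : ℂ)) ∂torusMeasure α d := by
        intro v
        rw [fracCoeff, ← integral_const_mul]
        refine integral_congr_ae (Eventually.of_forall fun x => ?_)
        simp only [fracKernel, hl]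
        ring
      have h1 := h l j
      rw [hv, hv] at h1
      have h2 := mul_left_cancel₀ (mul_ne_zero (fracAmplitude_ne_zero α d) (chirp_ne_zero α _)) h1
      simp only [Pi.sub_apply, mul_sub]
      rw [integral_sub (hci v) (hci w), h2, sub_self]
    filter_upwards [key] with x hx
    have hx' : chirp α x * (v x j : ℂ) = chirp α x * (w x j : ℂ) := sub_eq_zero.mp hx
    exact Complex.ofReal_injective (mul_left_cancel₀ (chirp_ne_zero α x) hx')
  refine Lp.ext ?_
  filter_upwards [ae_all_iff.mpr hj] with x hx
  exact PiLp.ext hx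

/-! ### Networks with one hidden layer -/

/-- The real part of the input of a hidden unit, as a function of the input field `v` and the
position `x`. -/
def preactivation (N : ℕ) (Λ : (Fin d → ℤ) → Fin n → ℂ) (B C : (Fin d → ℤ) → ℝ)
    (v : L2Space α d n) (x : Fin d → ℝ) : ℝ :=
  (∑ k ∈ waveNumbers d N, fracKernel (-α) k x * ∑ j, Λ k j * fracCoeff v k j).re +
    ∑ k ∈ waveNumbers d N, ((fracBasis α k x).re * B k + (fracBasis α k x).im * C k)

/-- The real vector space of all inputs of hidden units. -/
def preactivations (α : ℝ) (d n : ℕ) : Submodule ℝ (L2Space α d n → (Fin d → ℝ) → ℝ) where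
  -- Requiring the representation for all large truncations lets finitely many hidden units share
  -- one N.
  carrier := {h | ∃ Λ B C, ∀ᶠ N in atTop, h = preactivation N Λ B C}
  zero_mem' := ⟨0, 0, 0, Eventually.of_forall fun N => by
    funext v x; simp [preactivation]⟩
  add_mem' := by
    rintro f g ⟨Λ, B, C, hf⟩ ⟨Λ', B', C', hg⟩
    refine ⟨Λ + Λ', B + B', C + C', ?_⟩
    filter_upwards [hf, hg] with N hf hg
    rw [hf, hg]
    funext v x
    simp only [preactivation, Pi.add_apply, add_mul, mul_add, Finset.sum_add_distrib,
      Complex.add_re]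
    ring
  smul_mem' := by
    rintro c f ⟨Λ, B, C, hf⟩
    refine ⟨c • Λ, c • B, c • C, ?_⟩
    filter_upwards [hf] with N hf
    rw [hf]
    funext v x
    have h1 : ∑ k ∈ waveNumbers d N, fracKernel (-α) k x *
          ∑ j, c • Λ k j * fracCoeff v k j =
        c • ∑ k ∈ waveNumbers d N, fracKernel (-α) k x * ∑ j, Λ k j * fracCoeff v k j := by
      rw [Finset.smul_sum]
      refine Finset.sum_congr rfl fun k _ => ?_
      rw [← mul_smul_comm, Finset.smul_sum]
      simp only [smul_mul_assoc]
    have h2 : ∑ k ∈ waveNumbers d N,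
          ((fracBasis α k x).re * (c * B k) + (fracBasis α k x).im * (c * C k)) =
        c * ∑ k ∈ waveNumbers d N, ((fracBasis α k x).re * B k + (fracBasis α k x).im * C k) := by
      rw [Finset.mul_sum]
      exact Finset.sum_congr rfl fun k _ => by ring
    simp only [Pi.smul_apply, preactivation]
    rw [h1, Complex.smul_re, smul_eq_mul, smul_eq_mul]
    simp only [smul_eq_mul]
    rw [h2, mul_add]

theorem eventually_mem_waveNumbers (k : Fin d → ℤ) : ∀ᶠ N in atTop, k ∈ waveNumbers d N := by
  filter_upwards [eventually_ge_atTop (∑ i, (k i).natAbs)] with N hN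
  rw [waveNumbers, Fintype.mem_piFinset]
  intro i
  have := Finset.single_le_sum (f := fun i => (k i).natAbs) (fun _ _ => Nat.zero_le _)
    (Finset.mem_univ i)
  rw [Finset.mem_Icc]
  omega

/-- The multipliers may be complex: c = 1 and c = -i give the real and the imaginary part, so hidden
units see the whole complex coefficient. -/
theorem spectral_mem_preactivations (k : Fin d → ℤ) (j : Fin n) (c : ℂ) :
    (fun (v : L2Space α d n) x => (c * (fracKernel (-α) k x * fracCoeff v k j)).re) ∈
      preactivations α d n := by
  classical
  refine ⟨Pi.single k (Pi.single j c), 0, 0, ?_⟩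
  filter_upwards [eventually_mem_waveNumbers k] with N hN
  funext v x
  rw [preactivation, Finset.sum_eq_single_of_mem k hN fun l _ hl => by simp [hl],
    Pi.single_eq_same, Finset.sum_eq_single j (fun l _ hl => by simp [hl]) (by simp),
    Pi.single_eq_same]
  simp only [Pi.zero_apply, mul_zero, add_zero, Finset.sum_const_zero]
  congr 1
  ring

theorem fracBasis_mem_preactivations (k : Fin d → ℤ) (c : ℂ) :
    (fun (_ : L2Space α d n) x => (c * fracBasis α k x).re) ∈ preactivations α d n := by
  classical
  refine ⟨0, Pi.single k c.re, Pi.single k (-c.im), ?_⟩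
  filter_upwards [eventually_mem_waveNumbers k] with N hN
  funext v x
  rw [preactivation, Finset.sum_eq_zero fun l _ => by simp,
    Finset.sum_eq_single_of_mem k hN fun l _ hl => by simp [hl], Pi.single_eq_same,
    Pi.single_eq_same, Complex.mul_re, Complex.zero_re]
  ring

/-- At a fixed wave number the chirp factor of the embedding is a nonzero constant; dividing by it
leaves an ordinary character. -/
theorem trig_mem_preactivations {q : (Fin d → ℝ) → ℝ} (hq : q ∈ realTrig α d) :
    (fun (_ : L2Space α d n) x => q x) ∈ preactivations α d n := by
  have hchar : ∀ (k : Fin d → ℤ) (c : ℂ),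
      (fun (_ : L2Space α d n) x => (c * character α k x).re) ∈ preactivations α d n := by
    intro k c
    obtain ⟨l, hl⟩ := exists_fracChar_eq α k
    have := fracBasis_mem_preactivations (α := α) (n := n) l
      (c * (chirp α (fun i => (l i : ℝ)))⁻¹)
    simp only [fracBasis, hl] at this
    refine (congrArg (· ∈ preactivations α d n) ?_).mp this
    funext _ x
    rw [mul_assoc, inv_mul_cancel_left₀ (chirp_ne_zero α _)]
  have := mem_span_of_mem_realTrig hq
  clear hq
  induction this using Submodule.span_induction with
  | mem f hf =>
    rcases hf with ⟨k, rfl⟩ | ⟨k, rfl⟩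
    · simpa using hchar k 1
    · simpa using hchar k (-Complex.I)
  | zero => exact (preactivations α d n).zero_mem
  | add f g _ _ hf hg => exact (preactivations α d n).add_mem hf hg
  | smul c f _ hf => exact (preactivations α d n).smul_mem c hf

theorem contDiff_preactivation {h : L2Space α d n → (Fin d → ℝ) → ℝ}
    (hh : h ∈ preactivations α d n) (v : L2Space α d n) {m : WithTop ℕ∞} :
    ContDiff ℝ m (h v) := by
  obtain ⟨Λ, B, C, hN⟩ := hh
  obtain ⟨N, rfl⟩ := hN.exists
  have hb : ∀ k : Fin d → ℤ, ContDiff ℝ m (fracBasis α k : (Fin d → ℝ) → ℂ) := fun k =>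
    contDiff_const.mul (contDiff_fracChar α k)
  refine ContDiff.add (Complex.reCLM.contDiff.comp (ContDiff.sum fun k _ =>
    (contDiff_fracKernel (-α) k).mul contDiff_const)) (ContDiff.sum fun k _ => ?_)
  exact ((Complex.reCLM.contDiff.comp (hb k)).mul contDiff_const).add
    ((Complex.imCLM.contDiff.comp (hb k)).mul contDiff_const)

theorem continuous_preactivation {h : L2Space α d n → (Fin d → ℝ) → ℝ}
    (hh : h ∈ preactivations α d n) :
    Continuous fun y : L2Space α d n × (Fin d → ℝ) => h y.1 y.2 := by
  obtain ⟨Λ, B, C, hN⟩ := hh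
  obtain ⟨N, rfl⟩ := hN.exists
  have hb : ∀ k : Fin d → ℤ, Continuous (fracBasis α k : (Fin d → ℝ) → ℂ) := fun k =>
    continuous_const.mul (contDiff_fracChar α k (m := 0)).continuous
  refine Continuous.add (Complex.continuous_re.comp (continuous_finsetSum _ fun k _ => ?_))
    (continuous_finsetSum _ fun k _ => ?_)
  · exact ((continuous_fracKernel (-α) k).comp continuous_snd).mul
      (continuous_finsetSum _ fun j _ =>
        continuous_const.mul ((continuous_fracCoeff k j).comp continuous_fst))
  · exact ((Complex.continuous_re.comp ((hb k).comp continuous_snd)).mul continuous_const).add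
      ((Complex.continuous_im.comp ((hb k).comp continuous_snd)).mul continuous_const)

/-- The lifting that keeps the input field and adds one channel of position embedding per hidden
unit. -/
def shallowLifting {m : ℕ} (N : ℕ) (B C : Fin m → (Fin d → ℤ) → ℝ) : Lifting d n (n + m) where
  N := N
  A := Matrix.of (Fin.addCases (fun i => Pi.single i 1) fun _ => 0)
  B := fun k => Fin.addCases (fun _ => 0) fun i => B i k
  C := fun k => Fin.addCases (fun _ => 0) fun i => C i k

theorem shallowLifting_apply_castAdd {m : ℕ} (N : ℕ) (B C : Fin m → (Fin d → ℤ) → ℝ)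
    (v : (Fin d → ℝ) → EuclideanSpace ℝ (Fin n)) (x : Fin d → ℝ) (j : Fin n) :
    (shallowLifting N B C).apply α v x (Fin.castAdd m j) = ((v x j : ℝ) : ℂ) := by
  simp [shallowLifting, Lifting.apply, Matrix.mulVec, dotProduct, Pi.single_apply]

theorem shallowLifting_apply_natAdd {m : ℕ} (N : ℕ) (B C : Fin m → (Fin d → ℤ) → ℝ)
    (v : (Fin d → ℝ) → EuclideanSpace ℝ (Fin n)) (x : Fin d → ℝ) (l : Fin m) :
    (shallowLifting N B C).apply α v x (Fin.natAdd n l) =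
      ((∑ k ∈ waveNumbers d N, ((fracBasis α k x).re * B l k + (fracBasis α k x).im * C l k) :
        ℝ) : ℂ) := by
  simp [shallowLifting, Lifting.apply, Matrix.mulVec, dotProduct]

/-- The layer that feeds the hidden units: spectral multipliers act on the input field, and the
position embedding is passed on. -/
def hiddenLayer {m : ℕ} (N : ℕ) (Λ : Fin m → (Fin d → ℤ) → Fin n → ℂ) : Layer d (n + m) m where
  W := Matrix.of fun i => Fin.addCases (fun _ => 0) (Pi.single i 1)
  b := 0
  N := N
  R := fun k => Matrix.of fun i => Fin.addCases (fun j => Λ i k j) fun _ => 0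

theorem hiddenLayer_apply {m : ℕ} (N : ℕ) (Λ : Fin m → (Fin d → ℤ) → Fin n → ℂ)
    (w : (Fin d → ℝ) → Fin (n + m) → ℂ) (x : Fin d → ℝ) (l : Fin m) :
    (hiddenLayer N Λ).apply α w x l = w x (Fin.natAdd n l) +
      ∑ k ∈ waveNumbers d N, fracKernel (-α) k x *
        ∑ j, Λ l k j * frft α w k (Fin.castAdd m j) := by
  simp [hiddenLayer, Layer.apply, inverseFrft, Matrix.mulVec, dotProduct, Fin.sum_univ_add,
    Pi.single_apply]

/-- The pointwise linear layer with a real matrix. -/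
def readoutLayer (d : ℕ) {p q : ℕ} (c : Matrix (Fin q) (Fin p) ℝ) : Layer d p q where
  W := c.map (fun t => (t : ℂ))
  b := 0
  N := 0
  R := 0

theorem readoutLayer_apply {p q : ℕ} (c : Matrix (Fin q) (Fin p) ℝ)
    (w : (Fin d → ℝ) → Fin p → ℂ) (x : Fin d → ℝ) (i : Fin q) :
    (readoutLayer d c).apply α w x i = ∑ l, (c i l : ℂ) * w x l := by
  simp [readoutLayer, Layer.apply, inverseFrft, Matrix.mulVec, dotProduct]

/-- A network with one hidden layer of `m` units. -/
def shallowNetwork {du m : ℕ} (N : ℕ) (Λ : Fin m → (Fin d → ℤ) → Fin n → ℂ)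
    (B C : Fin m → (Fin d → ℤ) → ℝ) (c : Matrix (Fin du) (Fin m) ℝ) : Network d n du where
  p := n + m
  q := du
  lift := shallowLifting N B C
  layers := .cons (hiddenLayer N Λ) (.last (readoutLayer d c))
  Q := 1

theorem cgelu_re (z : ℂ) : (cgelu z).re = gelu z.re := by
  simp [cgelu]

/-- The activation treats real and imaginary parts separately and the readout weights are real, so
the final real part depends only on the real parts of the hidden inputs. -/
theorem shallowNetwork_apply {du m : ℕ} (N : ℕ) (Λ : Fin m → (Fin d → ℤ) → Fin n → ℂ)
    (B C : Fin m → (Fin d → ℤ) → ℝ) (c : Matrix (Fin du) (Fin m) ℝ) (v : L2Space α d n)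
    (x : Fin d → ℝ) (i : Fin du) :
    (shallowNetwork N Λ B C c).apply α ⇑v x i =
      ∑ l, c i l * gelu (preactivation N (Λ l) (B l) (C l) v x) := by
  have hz : ∀ l, ((hiddenLayer N Λ).apply α ((shallowLifting N B C).apply α ⇑v) x l).re =
      preactivation N (Λ l) (B l) (C l) v x := by
    intro l
    rw [hiddenLayer_apply, shallowLifting_apply_natAdd, Complex.add_re, Complex.ofReal_re, add_comm]
    simp only [frft, shallowLifting_apply_castAdd]
    rfl
  change (((1 : Matrix (Fin du) (Fin du) ℂ) *ᵥ (readoutLayer d c).apply α (fun x j =>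
    cgelu ((hiddenLayer N Λ).apply α ((shallowLifting N B C).apply α ⇑v) x j)) x) i).re = _
  rw [Matrix.one_mulVec, readoutLayer_apply, Complex.re_sum]
  exact Finset.sum_congr rfl fun l _ => by rw [Complex.re_ofReal_mul, cgelu_re, hz]

/-- Linear combinations of hidden units. -/
def hiddenUnits (α : ℝ) (d n : ℕ) : Submodule ℝ (L2Space α d n → (Fin d → ℝ) → ℝ) :=
  Submodule.span ℝ (Set.range fun (h : preactivations α d n) v x =>
    gelu ((h : L2Space α d n → (Fin d → ℝ) → ℝ) v x))

theorem gelu_comp_mem_hiddenUnits {h : L2Space α d n → (Fin d → ℝ) → ℝ}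
    (hh : h ∈ preactivations α d n) : (fun v x => gelu (h v x)) ∈ hiddenUnits α d n :=
  Submodule.subset_span ⟨⟨h, hh⟩, rfl⟩

/-- Vectors of linear combinations of hidden units are realized by networks. -/
theorem exists_network_of_mem_hiddenUnits {du : ℕ}
    {W : Fin du → L2Space α d n → (Fin d → ℝ) → ℝ} (hW : ∀ i, W i ∈ hiddenUnits α d n) :
    ∃ net : Network d n du, ∀ (v : L2Space α d n) x i, net.apply α ⇑v x i = W i v x := by
  classical
  simp only [hiddenUnits, Finsupp.mem_span_range_iff_exists_finsupp] at hW
  choose c hc using hW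
  -- All output components draw on one common finite set of hidden units.
  let T : Finset (preactivations α d n) := Finset.univ.biUnion fun i => (c i).support
  let e := T.equivFin
  let h : Fin T.card → preactivations α d n := fun l => (e.symm l).1
  choose Λ B C hN using fun l => (h l).2
  obtain ⟨N, hN⟩ := (eventually_all.mpr hN).exists
  refine ⟨shallowNetwork N Λ B C (Matrix.of fun i l => c i (h l)), fun v x i => ?_⟩
  rw [shallowNetwork_apply]
  have h1 : W i v x = ∑ g ∈ T, c i g * gelu (g.1 v x) := by
    have hsub : (c i).support ⊆ T := Finset.subset_biUnion_of_mem (fun i => (c i).support)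
      (Finset.mem_univ i)
    rw [← hc i, Finsupp.sum_of_support_subset _ hsub _ (by simp)]
    simp [Finset.sum_apply]
  rw [h1, ← Finset.sum_coe_sort T (fun g => c i g * gelu (g.1 v x)), ← e.symm.sum_comp]
  exact Finset.sum_congr rfl fun l _ => by rw [← hN l]; rfl

end CoNO

namespace CoNO

open Filter Topology

variable {α : ℝ} {d n : ℕ}

/-! ### Density of the networks -/

/-- Differences of hidden units whose inputs differ by a multiple of the boundary bump. -/
def flatUnits (α : ℝ) (d n r : ℕ) : Submodule ℝ (L2Space α d n → (Fin d → ℝ) → ℝ) :=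
  Submodule.span ℝ {W | ∃ h ∈ preactivations α d n, ∃ t : ℝ,
    W = fun v x => gelu (h v x + t * boundaryBump α d r x) - gelu (h v x)}

/-- The bump is a trigonometric polynomial, so a shift by a multiple of it is again a preactivation.
-/
theorem flatUnits_le_hiddenUnits (r : ℕ) : flatUnits α d n r ≤ hiddenUnits α d n := by
  refine Submodule.span_le.mpr ?_
  rintro W ⟨h, hh, t, rfl⟩
  have hb := (preactivations α d n).smul_mem t
    (trig_mem_preactivations (n := n) (boundaryBump_mem_realTrig α d r))
  exact (hiddenUnits α d n).sub_mem
    (gelu_comp_mem_hiddenUnits ((preactivations α d n).add_mem hh hb))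
    (gelu_comp_mem_hiddenUnits hh)

/-- Flatness holds for every input field, not only for those in a compact set; this is what makes
the network map all of H^s into H^{s'}. -/
theorem apply_mem_flatSubmodule (hα : Real.sin α ≠ 0) {m r : ℕ} (hm : m < 2 * r)
    {W : L2Space α d n → (Fin d → ℝ) → ℝ} (hW : W ∈ flatUnits α d n r) (v : L2Space α d n) :
    W v ∈ flatSubmodule α d m := by
  induction hW using Submodule.span_induction with
  | mem f hf =>
    obtain ⟨h, hh, t, rfl⟩ := hf
    exact comp_add_sub_comp_mem_flatSubmodule hα contDiff_gelu (contDiff_preactivation hh v) hm t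
  | zero => exact (flatSubmodule α d m).zero_mem
  | add f g _ _ hf hg => exact (flatSubmodule α d m).add_mem hf hg
  | smul c f _ hf => exact (flatSubmodule α d m).smul_mem c hf

/-! ### Uniform approximation over a compact family of input fields -/

variable {X : Type*} [TopologicalSpace X] [CompactSpace X]

/-- The continuous functions on `X × [0, |sin α|]^d` induced by a linear space of functions of an
input field and a position, when `X` parametrizes input fields. -/
def inducedSubmodule (V : Submodule ℝ (L2Space α d n → (Fin d → ℝ) → ℝ))
    (ι : X → L2Space α d n) : Submodule ℝ C(X × cube α d, ℝ) where
  carrier := {F | ∃ W ∈ V, ∀ y, F y = W (ι y.1) y.2}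
  zero_mem' := ⟨0, V.zero_mem, fun _ => rfl⟩
  add_mem' := by
    rintro F G ⟨W, hW, hF⟩ ⟨W', hW', hG⟩
    exact ⟨W + W', V.add_mem hW hW', fun y => by simp [hF, hG]⟩
  smul_mem' := by
    rintro c F ⟨W, hW, hF⟩
    exact ⟨c • W, V.smul_mem c hW, fun y => by simp [hF]⟩

/-- The weight `exp(p) - 1`, with `p` the boundary bump. -/
def bumpWeight (α : ℝ) (d r : ℕ) (x : Fin d → ℝ) : ℝ := Real.exp (boundaryBump α d r x) - 1

theorem continuous_bumpWeight (r : ℕ) : Continuous (bumpWeight α d r) :=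
  (Real.continuous_exp.comp (contDiff_of_mem_realTrig (boundaryBump_mem_realTrig α d r)
    (n := 0)).continuous).sub continuous_const

theorem bumpWeight_eq_zero_iff {r : ℕ} {x : Fin d → ℝ} :
    bumpWeight α d r x = 0 ↔ boundaryBump α d r x = 0 := by
  rw [bumpWeight, sub_eq_zero, Real.exp_eq_one_iff]

/-- The weight as a function on `X × [0, |sin α|]^d`. -/
def bumpWeightMap (X : Type*) [TopologicalSpace X] (α : ℝ) (d r : ℕ) : C(X × cube α d, ℝ) :=
  ⟨fun y => bumpWeight α d r y.2,
    (continuous_bumpWeight r).comp (continuous_subtype_val.comp continuous_snd)⟩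

/-- The exponentials of the inputs of hidden units. -/
def expSet (ι : X → L2Space α d n) : Set C(X × cube α d, ℝ) :=
  {F | ∃ h ∈ preactivations α d n, ∀ y, F y = Real.exp (h (ι y.1) y.2)}

theorem const_mem_preactivations (c : ℝ) :
    (fun (_ : L2Space α d n) (_ : Fin d → ℝ) => c) ∈ preactivations α d n :=
  trig_mem_preactivations (Subalgebra.algebraMap_mem (realTrig α d) c)

/-- Here (e^p - 1) e^h = e^{h+p} - e^h, a limit of differences of GeLUs whose arguments differ by a
multiple of the bump p. -/
theorem bumpWeightMap_mul_exp_mem {ι : X → L2Space α d n} (hι : Continuous ι) (r : ℕ)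
    {F : C(X × cube α d, ℝ)} (hF : F ∈ expSet ι) :
    bumpWeightMap X α d r * F ∈ (inducedSubmodule (flatUnits α d n r) ι).topologicalClosure := by
  obtain ⟨h, hh, hF⟩ := hF
  have hcont : ∀ h ∈ preactivations α d n,
      Continuous fun y : X × cube α d => h (ι y.1) y.2 := fun h hh =>
    (continuous_preactivation hh).comp ((hι.comp continuous_fst).prodMk
      (continuous_subtype_val.comp continuous_snd))
  have hp := trig_mem_preactivations (n := n) (boundaryBump_mem_realTrig α d r)
  have hg := hcont _ ((preactivations α d n).neg_mem ((preactivations α d n).add_mem hh hp))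
  have hh' := hcont _ ((preactivations α d n).neg_mem hh)
  obtain ⟨w, hw, hwx⟩ := exp_sub_exp_mem_closure (inducedSubmodule (flatUnits α d n r) ι)
    ⟨_, hg⟩ ⟨_, hh'⟩ fun m => by
      -- The arguments required are -m + h/m and the same plus p/m, so the multiple of the bump is
      -- 1/m. For m = 0 the inverse is 0 and the difference vanishes.
      let h1 : L2Space α d n → (Fin d → ℝ) → ℝ := fun v x => -(m : ℝ) + (m : ℝ)⁻¹ * h v x
      have h1mem : h1 ∈ preactivations α d n := (preactivations α d n).add_mem
        (const_mem_preactivations _) ((preactivations α d n).smul_mem _ hh)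
      have hc1 := hcont h1 h1mem
      have hb := (bumpWeightMap X α d r).continuous
      have hpc : Continuous fun y : X × cube α d => boundaryBump α d r y.2 := hcont _ hp
      refine ⟨⟨fun y => gelu (h1 (ι y.1) y.2 + (m : ℝ)⁻¹ * boundaryBump α d r y.2) -
        gelu (h1 (ι y.1) y.2), ?_⟩, ⟨_, Submodule.subset_span ⟨h1, h1mem, (m : ℝ)⁻¹, rfl⟩,
          fun y => rfl⟩, fun y => ?_⟩
      · exact (contDiff_gelu.continuous.comp (hc1.add (continuous_const.mul hpc))).sub
          (contDiff_gelu.continuous.comp hc1)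
      · simp only [ContinuousMap.coe_mk, Pi.neg_apply, Pi.add_apply, h1]
        congr 2 <;> ring
  have : bumpWeightMap X α d r * F = w := by
    ext y
    rw [hwx y, ContinuousMap.mul_apply, hF]
    simp only [ContinuousMap.coe_mk, Pi.neg_apply, Pi.add_apply, neg_neg, Real.exp_add]
    change (Real.exp (boundaryBump α d r y.2) - 1) * _ = _
    ring
  rwa [this]

/-- Preactivations are closed under addition, so their exponentials are closed under products and
the algebra is their span. Multiplication by the weight is linear and continuous, and so carries
over first to the span and then to its closure. -/
theorem bumpWeightMap_mul_mem {ι : X → L2Space α d n} (hι : Continuous ι) (r : ℕ)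
    {F : C(X × cube α d, ℝ)} (hF : F ∈ (Algebra.adjoin ℝ (expSet ι)).topologicalClosure) :
    bumpWeightMap X α d r * F ∈ (inducedSubmodule (flatUnits α d n r) ι).topologicalClosure := by
  have h1 : Subalgebra.toSubmodule (Algebra.adjoin ℝ (expSet ι)) =
      Submodule.span ℝ (expSet ι) := by
    refine Algebra.adjoin_eq_span_of_subset ℝ (Set.Subset.trans ?_ Submodule.subset_span)
    intro F hF
    induction hF using Submonoid.closure_induction with
    | mem x hx => exact hx
    | one => exact ⟨0, (preactivations α d n).zero_mem, fun y => by simp⟩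
    | mul F G _ _ hF hG =>
      obtain ⟨f, hf, hF⟩ := hF
      obtain ⟨g, hg, hG⟩ := hG
      exact ⟨f + g, (preactivations α d n).add_mem hf hg, fun y => by
        rw [ContinuousMap.mul_apply, hF, hG, ← Real.exp_add]; rfl⟩
  have h2 : Set.MapsTo (fun F => bumpWeightMap X α d r * F)
      (Algebra.adjoin ℝ (expSet ι) : Set C(X × cube α d, ℝ))
      (inducedSubmodule (flatUnits α d n r) ι).topologicalClosure := by
    intro F hF
    have hF' : F ∈ Submodule.span ℝ (expSet ι) := h1 ▸ hF
    clear hF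
    induction hF' using Submodule.span_induction with
    | mem F hF => exact bumpWeightMap_mul_exp_mem hι r hF
    | zero =>
      simp only [mul_zero]
      exact Submodule.zero_mem (inducedSubmodule (flatUnits α d n r) ι).topologicalClosure
    | add F G _ _ hF hG =>
      simp only [mul_add]
      exact Submodule.add_mem _ hF hG
    | smul c F _ hF =>
      simp only [mul_smul_comm]
      exact Submodule.smul_mem _ c hF
  have h3 := h2.closure (continuous_const_mul (bumpWeightMap X α d r)) hF
  rwa [(Submodule.isClosed_topologicalClosure _).closure_eq] at h3

/-- If the weight vanishes at one of two points that the exponentials do not separate, it vanishes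
at the other, and `F` is zero at both. Otherwise the positions are interior and coincide; cancelling
the nonvanishing kernel equates all fractional coefficients, so the input fields coincide as well.
-/
theorem mem_closure_adjoin_expSet (hα : Real.sin α ≠ 0) {ι : X → L2Space α d n}
    (hι : Continuous ι) (hinj : Function.Injective ι) {r : ℕ} (hr : r ≠ 0) (c : C(X, ℝ))
    {q : (Fin d → ℝ) → ℝ} {F : C(X × cube α d, ℝ)}
    (hF : ∀ y, F y = c y.1 * (bumpWeight α d r y.2 * q y.2)) :
    F ∈ (Algebra.adjoin ℝ (expSet ι)).topologicalClosure := by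
  refine mem_topologicalClosure_of_constant_on_fibres _ _ fun y z hyz => ?_
  have hH : ∀ h ∈ preactivations α d n, h (ι y.1) y.2 = h (ι z.1) z.2 := by
    intro h hh
    have hcont : Continuous fun y : X × cube α d => h (ι y.1) y.2 :=
      (continuous_preactivation hh).comp ((hι.comp continuous_fst).prodMk
        (continuous_subtype_val.comp continuous_snd))
    exact Real.exp_injective (hyz ⟨_, Real.continuous_exp.comp hcont⟩
      (Algebra.subset_adjoin ⟨h, hh, fun _ => rfl⟩))
  have ht : ∀ q ∈ realTrig α d, q y.2 = q z.2 := fun q hq => hH _ (trig_mem_preactivations hq)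
  rw [hF, hF]
  by_cases hb : boundaryBump α d r y.2 = 0
  · rw [bumpWeight_eq_zero_iff.mpr hb,
      bumpWeight_eq_zero_iff.mpr ((ht _ (boundaryBump_mem_realTrig α d r)) ▸ hb)]
    simp
  · have hx : (y.2 : Fin d → ℝ) = z.2 := eq_of_forall_realTrig hα
      (mem_Ioo_of_boundaryBump_ne_zero hr hα y.2.2 hb) z.2.2 ht
    have hv : ι y.1 = ι z.1 := eq_of_fracCoeff_eq hα fun k j => by
      have h1 : fracKernel (-α) k y.2 * fracCoeff (ι y.1) k j =
          fracKernel (-α) k y.2 * fracCoeff (ι z.1) k j := by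
        have hre := hH _ (spectral_mem_preactivations k j 1)
        have him := hH _ (spectral_mem_preactivations k j (-Complex.I))
        rw [← hx] at hre him
        exact Complex.ext (by simpa only [one_mul] using hre)
          (by simpa only [neg_mul, Complex.neg_re, Complex.I_mul_re, neg_neg] using him)
      exact mul_left_cancel₀ (fracKernel_ne_zero _ _ _) h1
    rw [hinj hv, hx]

/-- Hidden units approximate, uniformly, finite sums of products of a continuous functional of the
input field and a weighted trigonometric polynomial. -/
theorem exists_flatUnits_approx (hα : Real.sin α ≠ 0) {ι : X → L2Space α d n}
    (hι : Continuous ι) (hinj : Function.Injective ι) {r : ℕ} (hr : r ≠ 0) {J : Type*}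
    (t : Finset J) (c : J → C(X, ℝ)) {q : J → (Fin d → ℝ) → ℝ}
    (hq : ∀ j ∈ t, q j ∈ realTrig α d) {δ : ℝ} (hδ : 0 < δ) :
    ∃ W ∈ flatUnits α d n r, ∀ v, ∀ x ∈ cube α d,
      |∑ j ∈ t, c j v * (bumpWeight α d r x ^ 2 * q j x) - W (ι v) x| < δ := by
  have hmem : ∀ j ∈ t, ∃ F ∈ (inducedSubmodule (flatUnits α d n r) ι).topologicalClosure,
      ∀ y, F y = c j y.1 * (bumpWeight α d r y.2 ^ 2 * q j y.2) := by
    intro j hj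
    -- One factor of the weight makes `F` constant on the fibres of the algebra; the second is
    -- gained when passing to flat units.
    let F : C(X × cube α d, ℝ) := ⟨fun y => c j y.1 * (bumpWeight α d r y.2 * q j y.2),
      ((c j).continuous.comp continuous_fst).mul
        ((((continuous_bumpWeight r).mul
          (contDiff_of_mem_realTrig (hq j hj) (n := 0)).continuous).comp
          continuous_subtype_val).comp continuous_snd)⟩
    refine ⟨_, bumpWeightMap_mul_mem hι r
      (mem_closure_adjoin_expSet hα hι hinj hr (c j) (q := q j) (F := F) fun _ => rfl), fun y => ?_⟩
    change bumpWeight α d r y.2 * (c j y.1 * (bumpWeight α d r y.2 * q j y.2)) = _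
    ring
  choose! F hF hFy using hmem
  have hsum := Submodule.sum_mem _ hF
  obtain ⟨f, ⟨W, hW, hf⟩, hdist⟩ := Metric.mem_closure_iff.mp hsum δ hδ
  refine ⟨W, hW, fun v x hx => ?_⟩
  have h1 := (ContinuousMap.dist_apply_le_dist (f := ∑ j ∈ t, F j) (g := f)
    ((v, ⟨x, hx⟩) : X × cube α d)).trans_lt hdist
  rw [Real.dist_eq, hf, ContinuousMap.sum_apply] at h1
  rwa [Finset.sum_congr rfl fun j hj => hFy j hj (v, ⟨x, hx⟩)] at h1

/-- The weighted trigonometric vector fields. -/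
def weightedTrig (α : ℝ) (d n r : ℕ) : Submodule ℝ (L2Space α d n) where
  carrier := {u | ∃ q : Fin n → (Fin d → ℝ) → ℝ, (∀ i, q i ∈ realTrig α d) ∧
    ∀ᵐ x ∂torusMeasure α d, ∀ i, u x i = bumpWeight α d r x ^ 2 * q i x}
  zero_mem' := by
    refine ⟨0, fun i => Subalgebra.zero_mem _, ?_⟩
    filter_upwards [Lp.coeFn_zero (EuclideanSpace ℝ (Fin n)) 2 (torusMeasure α d)] with x hx i
    rw [hx]
    simp
  add_mem' := by
    rintro u v ⟨q, hq, hu⟩ ⟨p, hp, hv⟩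
    refine ⟨q + p, fun i => Subalgebra.add_mem _ (hq i) (hp i), ?_⟩
    filter_upwards [hu, hv, Lp.coeFn_add u v] with x h1 h2 h3 i
    rw [h3, Pi.add_apply, PiLp.add_apply, h1, h2]
    simp [mul_add]
  smul_mem' := by
    rintro c u ⟨q, hq, hu⟩
    refine ⟨c • q, fun i => Subalgebra.smul_mem _ (hq i) c, ?_⟩
    filter_upwards [hu, Lp.coeFn_smul c u] with x h1 h2 i
    rw [h2, Pi.smul_apply, PiLp.smul_apply, h1]
    simp [mul_left_comm]

/-- If w is orthogonal to this space, each weight² · w_i is orthogonal to every character and so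
vanishes almost everywhere; the weight is nonzero in the open cube. -/
theorem weightedTrig_topologicalClosure (hα : Real.sin α ≠ 0) (n r : ℕ) :
    (weightedTrig α d n r).topologicalClosure = ⊤ := by
  rw [Submodule.topologicalClosure_eq_top_iff, Submodule.eq_bot_iff]
  intro w hw
  rw [Submodule.mem_orthogonal] at hw
  have hbc : Continuous fun x => bumpWeight α d r x ^ 2 := (continuous_bumpWeight r).pow 2
  have hwi : ∀ i, Integrable (fun x => w x i) (torusMeasure α d) := fun i =>
    (EuclideanSpace.proj (𝕜 := ℝ) i).integrable_comp ((Lp.memLp w).integrable one_le_two)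
  have hmul : ∀ g : (Fin d → ℝ) → ℝ, Continuous g → ∀ i,
      Integrable (fun x => g x * w x i) (torusMeasure α d) := by
    intro g hg i
    obtain ⟨C, hC⟩ := (isCompact_Icc : IsCompact (cube α d)).exists_bound_of_continuousOn
      hg.continuousOn
    exact (hwi i).bdd_mul hg.aestronglyMeasurable ((ae_restrict_mem measurableSet_cube).mono hC)
  have horth : ∀ i, ∀ q ∈ realTrig α d,
      ∫ x, q x * (bumpWeight α d r x ^ 2 * w x i) ∂torusMeasure α d = 0 := by
    intro i q hq
    let u : (Fin d → ℝ) → EuclideanSpace ℝ (Fin n) := fun x =>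
      EuclideanSpace.single i (bumpWeight α d r x ^ 2 * q x)
    have hu : Continuous u := by
      have : u = fun x => (bumpWeight α d r x ^ 2 * q x) • EuclideanSpace.single i (1 : ℝ) := by
        funext x
        ext j
        simp [u]
      rw [this]
      exact (hbc.mul (contDiff_of_mem_realTrig hq (n := 0)).continuous).smul continuous_const
    have huLp : MemLp u 2 (torusMeasure α d) := by
      obtain ⟨C, hC⟩ := (isCompact_Icc : IsCompact (cube α d)).exists_bound_of_continuousOn
        hu.continuousOn
      exact MemLp.of_bound hu.aestronglyMeasurable C ((ae_restrict_mem measurableSet_cube).mono hC)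
    have h0 := hw huLp.toLp ⟨fun j => if j = i then q else 0, fun j => by
        by_cases hj : j = i
        · simpa [hj] using hq
        · simp [hj], by
        filter_upwards [huLp.coeFn_toLp] with x hx j
        rw [hx]
        by_cases hj : j = i <;> simp [u, hj]⟩
    rw [L2.inner_def] at h0
    rw [← h0]
    refine integral_congr_ae ?_
    filter_upwards [huLp.coeFn_toLp] with x hx
    rw [hx]
    simp only [u, EuclideanSpace.inner_single_left]
    simp
    ring
  have hzero : ∀ i, ∀ᵐ x ∂torusMeasure α d, w x i = 0 := by
    intro i
    have hint : Integrable (fun x => ((bumpWeight α d r x ^ 2 * w x i : ℝ) : ℂ))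
        (torusMeasure α d) := (hmul _ hbc i).ofReal
    have key := ae_eq_zero_of_integral_character_eq_zero hα hint fun k => by
      have hci : Integrable (fun x => character α k x * ((bumpWeight α d r x ^ 2 * w x i : ℝ) : ℂ))
          (torusMeasure α d) :=
        hint.bdd_mul (c := 1) (continuous_character α k).aestronglyMeasurable
          (Eventually.of_forall fun x => (norm_character α k x).le)
      refine Complex.ext ?_ ?_
      · have := Complex.reCLM.integral_comp_comm hci
        simp only [Complex.reCLM_apply, Complex.re_mul_ofReal] at this
        rw [← this, horth i _ (re_character_mem_realTrig α k), Complex.zero_re]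
      · have := Complex.imCLM.integral_comp_comm hci
        simp only [Complex.imCLM_apply, Complex.im_mul_ofReal] at this
        rw [← this, horth i _ (im_character_mem_realTrig α k), Complex.zero_im]
    filter_upwards [key, ae_torusMeasure_mem_Ioo] with x hx hxI
    have h1 : bumpWeight α d r x ^ 2 * w x i = 0 := Complex.ofReal_eq_zero.mp hx
    refine (mul_eq_zero.mp h1).resolve_left (pow_ne_zero 2 ?_)
    rw [Ne, bumpWeight_eq_zero_iff]
    exact (boundaryBump_pos hxI).ne'
  refine Lp.eq_zero_iff_ae_eq_zero.mpr ?_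
  filter_upwards [ae_all_iff.mpr hzero] with x hx
  exact PiLp.ext hx

/-- A continuous map from a compact space is uniformly approximated by finite combinations, with
continuous coefficients, of elements of a dense set. -/
theorem exists_finset_approx {E : Type*} [NormedAddCommGroup E] [NormedSpace ℝ E] {D : Set E}
    (hD : Dense D) {G : X → E} (hG : Continuous G) {ε : ℝ} (hε : 0 < ε) :
    ∃ (t : Finset E) (c : E → C(X, ℝ)), ↑t ⊆ D ∧ ∀ x, ‖G x - ∑ u ∈ t, c u x • u‖ ≤ ε := by
  classical
  choose u huD hu using fun x => hD.exists_dist_lt (G x) hε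
  obtain ⟨T, hT⟩ := CompactSpace.elim_nhds_subcover (fun x => {y | dist (G y) (u x) < ε})
    fun x => (isOpen_lt (hG.dist continuous_const) continuous_const).mem_nhds (hu x)
  let t : Finset E := T.image u
  have hcov : ∀ y, ∃ e ∈ t, ‖G y - e‖ < ε := by
    intro y
    have : y ∈ ⋃ x ∈ T, {y | dist (G y) (u x) < ε} := hT ▸ Set.mem_univ y
    simp only [Set.mem_iUnion] at this
    obtain ⟨x, hx, hy⟩ := this
    exact ⟨u x, Finset.mem_image_of_mem u hx, by rwa [← dist_eq_norm]⟩
  -- Unnormalized partition of unity: e contributes only where it lies within ε of G(y), so after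
  -- normalization the error is a convex combination of vectors of norm below ε.
  let b : E → X → ℝ := fun e y => max 0 (ε - ‖G y - e‖)
  have hb0 : ∀ e y, 0 ≤ b e y := fun e y => le_max_left _ _
  have hbc : ∀ e, Continuous (b e) := fun e =>
    continuous_const.max (continuous_const.sub (hG.sub continuous_const).norm)
  have hS : ∀ y, 0 < ∑ e ∈ t, b e y := by
    intro y
    obtain ⟨e, he, hlt⟩ := hcov y
    exact Finset.sum_pos' (fun e _ => hb0 e y) ⟨e, he, lt_max_of_lt_right (sub_pos.mpr hlt)⟩
  refine ⟨t, fun e => ⟨fun y => b e y / ∑ e ∈ t, b e y, (hbc e).div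
    (continuous_finsetSum _ fun e _ => hbc e) fun y => (hS y).ne'⟩, ?_, fun y => ?_⟩
  · intro e he
    obtain ⟨x, _, rfl⟩ := Finset.mem_image.mp (Finset.mem_coe.mp he)
    exact huD x
  · have hone : ∑ e ∈ t, b e y / ∑ e ∈ t, b e y = 1 := by
      rw [← Finset.sum_div, div_self (hS y).ne']
    have heq : G y - ∑ e ∈ t, (b e y / ∑ e ∈ t, b e y) • e =
        ∑ e ∈ t, (b e y / ∑ e ∈ t, b e y) • (G y - e) := by
      simp only [smul_sub, Finset.sum_sub_distrib]
      rw [← Finset.sum_smul, hone, one_smul]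
    change ‖G y - ∑ e ∈ t, (b e y / ∑ e ∈ t, b e y) • e‖ ≤ ε
    rw [heq]
    calc ‖∑ e ∈ t, (b e y / ∑ e ∈ t, b e y) • (G y - e)‖
        ≤ ∑ e ∈ t, (b e y / ∑ e ∈ t, b e y) * ε := by
          refine (norm_sum_le _ _).trans (Finset.sum_le_sum fun e _ => ?_)
          rw [norm_smul, Real.norm_of_nonneg (div_nonneg (hb0 e y) (hS y).le)]
          rcases le_or_gt ε ‖G y - e‖ with h | h
          · have : b e y = 0 := max_eq_left (sub_nonpos.mpr h)
            simp [this]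
          · exact mul_le_mul_of_nonneg_left h.le (div_nonneg (hb0 e y) (hS y).le)
      _ = ε := by rw [← Finset.sum_mul, hone, one_mul]

/-! ### The approximation theorem -/

theorem norm_le_card_mul {y : EuclideanSpace ℝ (Fin n)} {δ : ℝ} (h : ∀ i, |y i| ≤ δ) :
    ‖y‖ ≤ n * δ := by
  have h1 : ‖y‖ ≤ ∑ i, |y i| := by
    refine abs_le_of_sq_le_sq' ?_ (Finset.sum_nonneg fun i _ => abs_nonneg _) |>.2
    rw [EuclideanSpace.norm_sq_eq]
    exact Finset.sum_sq_le_sq_sum_of_nonneg fun i _ => abs_nonneg _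
  refine h1.trans ((Finset.sum_le_sum fun i _ => h i).trans_eq ?_)
  simp

theorem Sobolev.toL2_injective {s : ℝ} :
    Function.Injective (Sobolev.toL2 : Sobolev α s d n → L2Space α d n) :=
  Subtype.val_injective

/-- Complex neural operators approximate continuous operators on Sobolev spaces. -/
theorem exists_network_approx (s s' α : ℝ) (hs : 0 < s) (hs' : 0 < s') (hα : Real.sin α ≠ 0)
    (d da du : ℕ) (G : Sobolev α s d da → Sobolev α s' d du) (hG : Continuous G)
    (K : Set (Sobolev α s d da)) (hK : IsCompact K) (ε : ℝ) (hε : 0 < ε) :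
    ∃ (net : Network d da du) (N : Sobolev α s d da → Sobolev α s' d du),
      (∀ v, ⇑(N v).toL2 =ᵐ[torusMeasure α d] net.apply α ⇑v.toL2) ∧
      ∀ v ∈ K, ‖(G v).toL2 - (N v).toL2‖ ≤ ε := by
  have : CompactSpace K := isCompact_iff_compactSpace.mp hK
  let M := ⌈s'⌉₊
  have hM : s' ≤ 2 * M := by
    have h1 := Nat.le_ceil s'
    have h2 : (0 : ℝ) ≤ M := Nat.cast_nonneg _
    linarith
  -- Now s' ≤ 2M < 2r: the flat units have the 2M derivatives at the boundary that H^{s'} requires.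
  let r := M + 1
  let ι : K → L2Space α d da := fun v => v.1.toL2
  have hι : Continuous ι := (Sobolev.continuous_toL2 hs.le hα).comp continuous_subtype_val
  have hinj : Function.Injective ι := Sobolev.toL2_injective.comp Subtype.val_injective
  obtain ⟨t, c, ht, hc⟩ := exists_finset_approx
    ((Submodule.dense_iff_topologicalClosure_eq_top).mpr
      (weightedTrig_topologicalClosure (d := d) hα du r))
    (((Sobolev.continuous_toL2 hs'.le hα).comp hG).comp (continuous_subtype_val (p := (· ∈ K))))
    (half_pos hε)
  have ht' : ∀ u ∈ t, u ∈ weightedTrig α d du r := fun u hu => ht hu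
  choose! q hq hqx using ht'
  -- The square root of the volume of the torus, which bounds the L² norm by the supremum norm.
  set b : ℝ := (measureUnivNNReal (torusMeasure α d) : ℝ) ^ (2 : ENNReal).toReal⁻¹ with hb
  have hb0 : 0 ≤ b := Real.rpow_nonneg (NNReal.coe_nonneg _) _
  obtain ⟨δ, hδ, hδb⟩ : ∃ δ > 0, b * (du * δ) ≤ ε / 2 := by
    have hden : 0 < b * du + 1 := by positivity
    -- The added 1 keeps the denominator positive even without output channels.
    refine ⟨ε / 2 / (b * du + 1), by positivity, ?_⟩
    rw [← mul_assoc, mul_div_assoc', div_le_iff₀ hden]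
    nlinarith [half_pos hε]
  choose W hW hWδ using fun i => exists_flatUnits_approx hα hι hinj (Nat.succ_ne_zero M) t c
    (q := fun u => q u i) (fun u hu => hq u hu i) hδ
  obtain ⟨net, hnet⟩ := exists_network_of_mem_hiddenUnits
    fun i => flatUnits_le_hiddenUnits r (hW i)
  choose N hN using fun v : Sobolev α s d da => exists_sobolev_of_mem_flatSubmodule (n := du)
    (s := s') hα (M := M) hM (w := fun x => WithLp.toLp 2 fun i => W i v.toL2 x)
    fun i => apply_mem_flatSubmodule hα (by omega) (hW i) v.toL2
  refine ⟨net, N, fun v => ?_, fun v hv => ?_⟩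
  · filter_upwards [hN v] with x hx
    rw [hx]
    exact PiLp.ext fun i => (hnet v.toL2 x i).symm
  · have h1 := hc ⟨v, hv⟩
    have h2 : ‖∑ u ∈ t, c u ⟨v, hv⟩ • u - (N v).toL2‖ ≤ b * (du * δ) := by
      refine Lp.norm_le_of_ae_bound (by positivity) ?_
      have hall : ∀ᵐ x ∂torusMeasure α d, ∀ u ∈ t, ∀ i,
          (u : L2Space α d du) x i = bumpWeight α d r x ^ 2 * q u i x :=
        (Finset.eventually_all t).mpr hqx
      filter_upwards [Lp.coeFn_sub (∑ u ∈ t, c u ⟨v, hv⟩ • u) (N v).toL2, hN v, hall,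
        Lp.coeFn_finsetSum t (fun u => c u ⟨v, hv⟩ • u),
        (Finset.eventually_all t).mpr fun u _ => Lp.coeFn_smul (c u ⟨v, hv⟩) u,
        MeasureTheory.ae_restrict_mem measurableSet_cube] with x e1 e2 e3 e4 e5 hx
      refine norm_le_card_mul fun i => ?_
      have e6 : (∑ u ∈ t, c u ⟨v, hv⟩ • u : L2Space α d du) x i =
          ∑ u ∈ t, c u ⟨v, hv⟩ * (bumpWeight α d r x ^ 2 * q u i x) := by
        rw [e4, Finset.sum_apply, WithLp.ofLp_sum, Finset.sum_apply]
        refine Finset.sum_congr rfl fun u hu => ?_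
        rw [e5 u hu, Pi.smul_apply, PiLp.smul_apply, e3 u hu, smul_eq_mul]
      rw [e1, Pi.sub_apply, PiLp.sub_apply, e6, e2]
      exact (hWδ i ⟨v, hv⟩ x hx).le
    calc ‖(G v).toL2 - (N v).toL2‖
        ≤ ‖(G v).toL2 - ∑ u ∈ t, c u ⟨v, hv⟩ • u‖ +
          ‖∑ u ∈ t, c u ⟨v, hv⟩ • u - (N v).toL2‖ := norm_sub_le_norm_sub_add_norm_sub _ _ _
      _ ≤ ε / 2 + ε / 2 := add_le_add h1 (h2.trans hδb)
      _ = ε := add_halves ε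

end CoNO

end

theorem theorem4p3 (s s' α : ℝ) (hs : 0 < s) (hs' : 0 < s') (hα : Real.sin α ≠ 0)
    (d da du : ℕ) (G : CoNO.Sobolev α s d da → CoNO.Sobolev α s' d du) (hG : Continuous G)
    (K : Set (CoNO.Sobolev α s d da)) (hK : IsCompact K) (ε : ℝ) (hε : 0 < ε) :
    ∃ (net : CoNO.Network d da du) (N : CoNO.Sobolev α s d da → CoNO.Sobolev α s' d du),
      (∀ v, ⇑(N v).toL2 =ᵐ[CoNO.torusMeasure α d] net.apply α ⇑v.toL2) ∧
      ∀ v ∈ K, ‖(G v).toL2 - (N v).toL2‖ ≤ ε := by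
  exact CoNO.exists_network_approx s s' α hs hs' hα d da du G hG K hK ε hε
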